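/- Let $Q$ be a (finite-dimensional, Hausdorff) smooth manifold with tangent projection $\tau_Q:TQ\to Q$. Let $L:TQ\to\mathbb R$ be a regular Lagrangian, with energy $E_L=\Delta L-L$ and Poincaré–Cartan form $\omega_L=-d(S^*dL)$, where $\Delta$ is the Liouville vector field and $S$ the vertical endomorphism of $TQ$. Let $\mathcal D$ be a regular distribution on $Q$, i.e. a smooth vector subbundle of $TQ$, regarded as a submanifold of $TQ$. For $v\in\mathcal D$ put $F^o_v=S^*((T_v\mathcal D)^o)$ and assume that $(L,\mathcal D)$ is a regular nonholonomic system: $\dim (T_v\mathcal D)^o=\dim F^o_v$ and $T_v\mathcal D\cap\sharp(F^o_v)=\{0\}$ for all $v\in\mathcal D$, where $\sharp$ is the inverse of $X\mapsto i_X\omega_L$. Let $\Gamma_{nh}\in\mathfrak X(\mathcal D)$ be the nonholonomic dynamics, that is, the smooth vector field on $\mathcal D$ with $S(\Gamma_{nh})=\Delta$ (a SODE) and $i_{\Gamma_{nh}}\omega_L-dE_L\in F^o$ along $\mathcal D$. For a vector field $X$ with flow $\phi^X_t$ let $M_h^X$ be the set of points $v$ such that $\phi^X_t(v)$ is defined for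 all $t\in[0,h]$. Define the nonholonomic exponential map $$\exp_h^{\Gamma_{nh}}:M_h^{\Gamma_{nh}}\subseteq\mathcal D\to Q\times Q,\qquad v_{q_0}\mapsto(q_0,\tau_Q(\phi_h^{\Gamma_{nh}}(v_{q_0}))),$$ and, for a SODE $\Gamma$ on $TQ$ (a smooth vector field on $TQ$ with $S(\Gamma)=\Delta$), the map $\exp_h^{\Gamma}:M_h^{\Gamma}\to Q\times Q$, $v_{q_0}\mapsto(q_0,\tau_Q(\phi_h^{\Gamma}(v_{q_0})))$. Let $\Gamma$ be a SODE on $TQ$ with $\Gamma|_{\mathcal D}=\Gamma_{nh}$. Then: 1. for every $h>0$, $M_h^{\Gamma_{nh}}\subseteq M_h^{\Gamma}$ and $\exp_h^{\Gamma_{nh}}=(\exp_h^{\Gamma})|_{M_h^{\Gamma_{nh}}}$; 2. for every $v_0\in\mathcal D$ there is $h_0>0$ such that for every $h\in(0,h_0)$ there is an open subset $\mathcal U_h$ of $\mathcal D$ with $v_0\in\mathcal U_h\subseteq M_h^{\Gamma_{nh}}$ on which $\exp_h^{\Gamma_{nh}}:\mathcal U_h\to Q\times Q$ is a smooth embedding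 (an immersion that is a homeomorphism onto its image). Thus $\exp_h^{\Gamma_{nh}}(\mathcal U_h)$ is an embedded submanifold of $Q\times Q$. -/

import Mathlib

open scoped Manifold ContDiff Topology
open Set Bundle

noncomputable section

/-! ### Flows of vector fields on a manifold -/

section Flow

variable {E : Type*} [NormedAddCommGroup E] [NormedSpace ℝ E]
  {H : Type*} [TopologicalSpace H] {I : ModelWithCorners ℝ E H}
  {M : Type*} [TopologicalSpace M] [ChartedSpace H M]

/-- `X` is a smooth vector field on `M`. -/
def IsSmoothVectorField [IsManifold I ∞ M] (X : ∀ x : M, TangentSpace I x) : Prop :=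
  ContMDiff I I.tangent ∞ (fun x => (⟨x, X x⟩ : TangentBundle I M))

/-- `IsFlowValue X t x y`: some integral curve of `X`, defined on an open interval that contains
`0` and `t`, takes the value `x` at time `0` and the value `y` at time `t`. -/
def IsFlowValue (X : ∀ x : M, TangentSpace I x) (t : ℝ) (x y : M) : Prop :=
  ∃ (γ : ℝ → M) (a b : ℝ), 0 ∈ Ioo a b ∧ t ∈ Ioo a b ∧
    IsMIntegralCurveOn γ X (Ioo a b) ∧ γ 0 = x ∧ γ t = y

/-- The time `t` flow `φ_t(x)` of `X` is defined at `x`. -/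
def FlowDefinedAt (X : ∀ x : M, TangentSpace I x) (t : ℝ) (x : M) : Prop :=
  ∃ y, IsFlowValue X t x y

open Classical in
/-- The flow `φ_t(x)` of `X`. The value is meaningful where `FlowDefinedAt X t x` holds (it is then
the unique flow value, if `X` is smooth on a boundaryless Hausdorff manifold); elsewhere it is the
junk value `x`. -/
def flow (X : ∀ x : M, TangentSpace I x) (t : ℝ) (x : M) : M :=
  if h : FlowDefinedAt X t x then h.choose else x

/-- The set `M_h` of the points `x` such that `φ_t(x)` is defined for all `t ∈ [0, h]`. -/
def flowDomain (X : ∀ x : M, TangentSpace I x) (h : ℝ) : Set M :=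
  {x | ∀ t ∈ Icc 0 h, FlowDefinedAt X t x}

/-- The exterior derivative of a one-form `θ` on a boundaryless manifold, computed in the preferred chart `φ` at `x`: if
`A y = θ_{φ⁻¹ y} ∘ T_y φ⁻¹` is the local representative of `θ`, then
`dθ_x (u, w) = DA(φ x)(φ_* u)(φ_* w) - DA(φ x)(φ_* w)(φ_* u)`. -/
def extDerivOneForm (θ : ∀ x : M, TangentSpace I x →L[ℝ] ℝ) (x : M) :
    TangentSpace I x →L[ℝ] TangentSpace I x →L[ℝ] ℝ :=
  let φ := extChartAt I x
  let A : E → E →L[ℝ] ℝ := fun y => (θ (φ.symm y)).comp (mfderiv 𝓘(ℝ, E) I φ.symm y)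
  let P : TangentSpace I x →L[ℝ] E := mfderiv I 𝓘(ℝ, E) φ x
  let B : E →L[ℝ] E →L[ℝ] ℝ := fderiv ℝ A (φ x)
  ((ContinuousLinearMap.precomp ℝ P).comp (B - B.flip)).comp P

end Flow

/-! ### The geometry of the tangent bundle -/

section TangentGeometry

variable {E : Type*} [NormedAddCommGroup E] [NormedSpace ℝ E]
  {Q : Type*} [TopologicalSpace Q] [ChartedSpace E Q] [IsManifold 𝓘(ℝ, E) ∞ Q]

/-- The canonical projection `τ_Q : TQ → Q`. -/
def tauQ (v : TangentBundle 𝓘(ℝ, E) Q) : Q := v.proj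

/-- The vertical lift `w ↦ w^V_v`, from `T_qQ` to `T_v(TQ)`, where `v ∈ T_qQ`: the differential at
`v` of the inclusion of the vector space `T_qQ` in `TQ`, so that `w^V_v = d/dt|₀ (v + t w)`. -/
def verticalLift (v : TangentBundle 𝓘(ℝ, E) Q) :
    TangentSpace 𝓘(ℝ, E) v.proj →L[ℝ] TangentSpace 𝓘(ℝ, E).tangent v :=
  mfderiv 𝓘(ℝ, E) 𝓘(ℝ, E).tangent
    (fun w : E => (⟨v.proj, w⟩ : TangentBundle 𝓘(ℝ, E) Q)) v.snd

/-- The Liouville vector field `Δ(v) = v^V_v`. -/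
def liouville (v : TangentBundle 𝓘(ℝ, E) Q) : TangentSpace 𝓘(ℝ, E).tangent v :=
  verticalLift v v.snd

/-- The vertical endomorphism `S(X_v) = (T_v τ_Q (X_v))^V_v`. -/
def verticalEndo (v : TangentBundle 𝓘(ℝ, E) Q) :
    TangentSpace 𝓘(ℝ, E).tangent v →L[ℝ] TangentSpace 𝓘(ℝ, E).tangent v :=
  (verticalLift v).comp (mfderiv 𝓘(ℝ, E).tangent 𝓘(ℝ, E) tauQ v)

/-- `Γ` is a second order differential equation on `Q`: a smooth vector field on `TQ` such that
`S(Γ) = Δ`. -/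
structure IsSODE (Γ : ∀ v : TangentBundle 𝓘(ℝ, E) Q, TangentSpace 𝓘(ℝ, E).tangent v) : Prop where
  smooth : IsSmoothVectorField Γ
  verticalEndo_eq : ∀ v, verticalEndo v (Γ v) = liouville v

/-- The differential of a real function on `TQ`. -/
def dTQ (f : TangentBundle 𝓘(ℝ, E) Q → ℝ) (v : TangentBundle 𝓘(ℝ, E) Q) :
    TangentSpace 𝓘(ℝ, E).tangent v →L[ℝ] ℝ :=
  mfderiv 𝓘(ℝ, E).tangent 𝓘(ℝ, ℝ) f v

/-- The energy `E_L = Δ L - L`. -/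
def energy (L : TangentBundle 𝓘(ℝ, E) Q → ℝ) (v : TangentBundle 𝓘(ℝ, E) Q) : ℝ :=
  dTQ L v (liouville v) - L v

/-- The Poincaré-Cartan two-form `ω_L = - d(S^* dL)`. -/
def omegaL (L : TangentBundle 𝓘(ℝ, E) Q → ℝ) (v : TangentBundle 𝓘(ℝ, E) Q) :
    TangentSpace 𝓘(ℝ, E).tangent v →L[ℝ] TangentSpace 𝓘(ℝ, E).tangent v →L[ℝ] ℝ :=
  -extDerivOneForm (I := 𝓘(ℝ, E).tangent) (M := TangentBundle 𝓘(ℝ, E) Q)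
    (fun u => (dTQ L u).comp (verticalEndo u)) v

/-- `L` is a regular Lagrangian: a smooth function on `TQ` whose fibre Hessian
`∂²L/∂q̇ⁱ∂q̇ʲ` is everywhere nondegenerate. -/
structure IsRegularLagrangian (L : TangentBundle 𝓘(ℝ, E) Q → ℝ) : Prop where
  smooth : ContMDiff 𝓘(ℝ, E).tangent 𝓘(ℝ, ℝ) ∞ L
  hessian_nondegenerate : ∀ (q : Q) (w a : E),
    (∀ b : E, fderiv ℝ (fderiv ℝ fun u : E => L ⟨q, u⟩) w a b = 0) → a = 0

/-- The exponential map `exp_h^Γ(v) = (τ_Q v, τ_Q (φ_h^Γ v))` of a vector field `Γ` on `TQ`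
(meaningful on `flowDomain Γ h`). -/
def sodeExp (Γ : ∀ v : TangentBundle 𝓘(ℝ, E) Q, TangentSpace 𝓘(ℝ, E).tangent v) (h : ℝ)
    (v : TangentBundle 𝓘(ℝ, E) Q) : Q × Q :=
  (tauQ v, tauQ (flow Γ h v))

end TangentGeometry

/-! ### Nonholonomic systems -/

section Nonholonomic

variable {E : Type*} [NormedAddCommGroup E] [NormedSpace ℝ E]
  {Q : Type*} [TopologicalSpace Q] [ChartedSpace E Q] [IsManifold 𝓘(ℝ, E) ∞ Q]
  (F : Type*) [NormedAddCommGroup F] [NormedSpace ℝ F]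
  (D : ∀ q : Q, Submodule ℝ (TangentSpace 𝓘(ℝ, E) q))

/-- The total space of a distribution `D`, that is, the constraint submanifold. -/
abbrev DistTotal : Type _ := TotalSpace F (fun q : Q => ↥(D q))

variable {F D}

/-- The inclusion of the total space of the distribution in `TQ`. -/
def distIncl (v : DistTotal F D) : TangentBundle 𝓘(ℝ, E) Q := ⟨v.proj, v.snd.1⟩

variable [TopologicalSpace (DistTotal F D)] [FiberBundle F (fun q : Q => ↥(D q))]

/-- The differential at `v ∈ D` of the inclusion `D → TQ`. -/
def dIncl (v : DistTotal F D) :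
    TangentSpace (𝓘(ℝ, E).prod 𝓘(ℝ, F)) v →L[ℝ] TangentSpace 𝓘(ℝ, E).tangent (distIncl v) :=
  mfderiv (𝓘(ℝ, E).prod 𝓘(ℝ, F)) 𝓘(ℝ, E).tangent distIncl v

/-- `T_vD`, as a subspace of `T_v(TQ)`. -/
def tangentD (v : DistTotal F D) : Submodule ℝ (TangentSpace 𝓘(ℝ, E).tangent (distIncl v)) :=
  LinearMap.range (dIncl v).toLinearMap

/-- `F^o_v = S^*((T_vD)^o)`, a subspace of the dual of `T_v(TQ)`. -/
def annF (v : DistTotal F D) :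
    Submodule ℝ (Module.Dual ℝ (TangentSpace 𝓘(ℝ, E).tangent (distIncl v))) :=
  (tangentD v).dualAnnihilator.map (verticalEndo (distIncl v)).toLinearMap.dualMap

/-- The nonholonomic system `(L, D)` is regular: the admissibility and compatibility conditions
hold along `D`. Compatibility is `T_vD ∩ ♯(F^o_v) = {0}`, where `♯` is the inverse of
`♭ : X ↦ i_X ω_L`. -/
structure IsRegularNonholonomic (F : Type*) [NormedAddCommGroup F] [NormedSpace ℝ F]
    (D : ∀ q : Q, Submodule ℝ (TangentSpace 𝓘(ℝ, E) q))
    [TopologicalSpace (DistTotal F D)] [FiberBundle F (fun q : Q => ↥(D q))]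
    (L : TangentBundle 𝓘(ℝ, E) Q → ℝ) : Prop where
  admissible : ∀ v : DistTotal F D,
    Module.finrank ℝ (tangentD v).dualAnnihilator = Module.finrank ℝ (annF v)
  compatible : ∀ (v : DistTotal F D), ∀ X ∈ tangentD v,
    (omegaL L (distIncl v) X).toLinearMap ∈ annF v → X = 0

/-- `Γnh` is the nonholonomic dynamics of the system `(L, D)`: a smooth vector field on the
manifold `D` which is a SODE, `S(Γnh) = Δ`, and satisfies `i_{Γnh} ω_L - dE_L ∈ F^o`. -/
structure IsNonholonomicDynamics [VectorBundle ℝ F (fun q : Q => ↥(D q))]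
    [ContMDiffVectorBundle ∞ F (fun q : Q => ↥(D q)) 𝓘(ℝ, E)]
    (L : TangentBundle 𝓘(ℝ, E) Q → ℝ)
    (Γnh : ∀ v : DistTotal F D, TangentSpace (𝓘(ℝ, E).prod 𝓘(ℝ, F)) v) : Prop where
  smooth : IsSmoothVectorField Γnh
  verticalEndo_eq : ∀ v, verticalEndo (distIncl v) (dIncl v (Γnh v)) = liouville (distIncl v)
  dynamics : ∀ v,
    (omegaL L (distIncl v) (dIncl v (Γnh v)) - dTQ (energy L) (distIncl v)).toLinearMap ∈ annF v

/-- The nonholonomic exponential map `exp_h(v) = (q₀, τ_Q (φ_h v))`, for `v ∈ D_{q₀}`, where `φ` is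
the flow on the manifold `D` of `Γnh` (meaningful on `flowDomain Γnh h`). -/
def nhExp (Γnh : ∀ v : DistTotal F D, TangentSpace (𝓘(ℝ, E).prod 𝓘(ℝ, F)) v) (h : ℝ)
    (v : DistTotal F D) : Q × Q :=
  (v.proj, tauQ (distIncl (flow Γnh h v)))

end Nonholonomic

end

/-!
For the SODE `Γ` on `TQ`, the curves of `Γnh` in `D` are mapped by the inclusion `D → TQ` to integral
curves of `Γ`, since the two fields are related by it. As `TQ` is Hausdorff, integral curves of `Γ`
are unique, so the two exponential maps agree (`nhExp_eq_sodeExp`).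

For the embedding, read `Γ` in a natural chart of `TQ`. The point of the argument is that the local
flow can be written as `(h, y) ↦ y + h • B (h, y)` with `B` jointly smooth up to and including
`h = 0`, where `B (0, ·)` is the field itself (`exists_smooth_flow_quotient`). Mathlib has no smooth
dependence of solutions on the initial condition, so it is proved here: after rescaling time, a
solution is a zero `γ ∈ C([-1, 1], V)` of `γ - x - ε ∫ f ∘ γ`, this map is smooth because
superposition operators are (`contDiff_postcomp`), and the implicit function theorem applies at
`ε = 0`. Integrating `f` along the solution yields the quotient `B`.

Since `Γ` is a SODE, the base component of the field in the chart is the fibre coordinate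
(`IsSODE.chartField_fst`), so the exponential map reads `(q, w) ↦ (q, q + h • B₁ (h, q, w))` with
`∂B₁/∂w = id` at `h = 0`. Hence `∂B₁/∂w` is invertible at the given point for all small `h`, and for
`h > 0` the exponential map of `Γ` has an injective derivative there. Composing with the inclusion of
`D`, which is an immersion because it is fibrewise linear and injective
(`injective_fderiv_distInclInCharts`), and applying the local immersion theorem
(`exists_isSmoothEmbedding_of_injective_fderiv`) gives the open set on which the nonholonomic
exponential map is an embedding.
-/

universe u

/-! ### Superposition operators on spaces of continuous functions -/

section Superposition

set_option synthInstance.maxHeartbeats 200000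

variable {K : Type*} [TopologicalSpace K] [CompactSpace K]

/-- The pointwise application `(A, h) ↦ (t ↦ b (A t) (h t))` of a bounded bilinear map `b` to two
continuous functions, as a bounded bilinear map. -/
noncomputable def pointwiseBilin (K : Type*) [TopologicalSpace K] [CompactSpace K] {P V W : Type*}
    [NormedAddCommGroup P] [NormedSpace ℝ P] [NormedAddCommGroup V] [NormedSpace ℝ V]
    [NormedAddCommGroup W] [NormedSpace ℝ W] (b : P →L[ℝ] V →L[ℝ] W) :
    C(K, P) →L[ℝ] C(K, V) →L[ℝ] C(K, W) :=
  LinearMap.mkContinuous₂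
    (LinearMap.mk₂ ℝ
      (fun (A : C(K, P)) (h : C(K, V)) =>
        (⟨fun t => b (A t) (h t), (b.continuous.comp A.continuous).clm_apply h.continuous⟩ :
          C(K, W)))
      (fun A A' h => by ext t; simp) (fun c A h => by ext t; simp)
      (fun A h h' => by ext t; simp) (fun c A h => by ext t; simp))
    ‖b‖
    (fun A h => by
      rw [ContinuousMap.norm_le _ (by positivity)]
      intro t
      exact (b.le_opNorm₂ (A t) (h t)).trans (by
        gcongr
        · exact A.norm_coe_le_norm t
        · exact h.norm_coe_le_norm t))

@[simp]
theorem pointwiseBilin_apply {P V W : Type*} [NormedAddCommGroup P] [NormedSpace ℝ P]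
    [NormedAddCommGroup V] [NormedSpace ℝ V] [NormedAddCommGroup W] [NormedSpace ℝ W]
    (b : P →L[ℝ] V →L[ℝ] W) (A : C(K, P)) (h : C(K, V)) (t : K) :
    pointwiseBilin K b A h t = b (A t) (h t) := rfl

/-- Continuity of `γ ↦ g ∘ γ` in the topology of uniform convergence. -/
theorem exists_dist_postcomp_lt {V P : Type*} [PseudoMetricSpace V] [PseudoMetricSpace P]
    (g : C(V, P)) (γ : C(K, V)) {ε : ℝ} (hε : 0 < ε) :
    ∃ δ > 0, ∀ γ' : C(K, V), dist γ' γ < δ → ∀ t, dist (g (γ' t)) (g (γ t)) < ε := by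
  have hcont : ContinuousAt (fun γ : C(K, V) => g.comp γ) γ := g.continuous_postcomp.continuousAt
  obtain ⟨δ, hδ, hball⟩ := Metric.continuousAt_iff.1 hcont ε hε
  exact ⟨δ, hδ, fun γ' h => (ContinuousMap.dist_lt_iff hε).1 (hball h)⟩

theorem hasFDerivAt_postcomp {V W : Type*} [NormedAddCommGroup V] [NormedSpace ℝ V]
    [NormedAddCommGroup W] [NormedSpace ℝ W] (g : C(V, W)) (g' : C(V, V →L[ℝ] W))
    (hg : ∀ x, HasFDerivAt g (g' x) x) (γ : C(K, V)) :
    HasFDerivAt (fun γ : C(K, V) => g.comp γ)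
      (pointwiseBilin K (ContinuousLinearMap.id ℝ (V →L[ℝ] W)) (g'.comp γ)) γ := by
  rw [hasFDerivAt_iff_isLittleO_nhds_zero, Asymptotics.isLittleO_iff]
  intro ε hε
  obtain ⟨δ, hδ, hball⟩ := exists_dist_postcomp_lt g' γ hε
  filter_upwards [Metric.ball_mem_nhds (0 : C(K, V)) hδ] with h hh
  rw [mem_ball_zero_iff] at hh
  rw [ContinuousMap.norm_le _ (by positivity)]
  intro t
  -- the mean value inequality on the segment from `γ t` to `γ t + h t`
  have key : ‖g (γ t + h t) - g (γ t) - g' (γ t) (γ t + h t - γ t)‖ ≤ ε * ‖γ t + h t - γ t‖ := by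
    refine (convex_segment (𝕜 := ℝ) (γ t) (γ t + h t)).norm_image_sub_le_of_norm_hasFDerivWithin_le'
      (f' := g') (fun x _ => (hg x).hasFDerivWithinAt) ?_ (left_mem_segment ℝ _ _)
      (right_mem_segment ℝ _ _)
    intro x hx
    rw [segment_eq_image'] at hx
    obtain ⟨s, ⟨hs0, hs1⟩, rfl⟩ := hx
    have h1 : dist (γ + s • h) γ < δ := by
      rw [dist_eq_norm, add_sub_cancel_left, norm_smul, Real.norm_of_nonneg hs0]
      exact (mul_le_of_le_one_left (norm_nonneg _) hs1).trans_lt hh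
    have h2 := hball _ h1 t
    rw [dist_eq_norm] at h2
    simpa using h2.le
  rw [add_sub_cancel_left] at key
  refine (le_of_eq ?_).trans (key.trans ?_)
  · simp
  gcongr
  exact h.norm_coe_le_norm t

/-- Superposition operators `γ ↦ g ∘ γ` between spaces of continuous functions on a compact space
inherit the smoothness of `g`. -/
theorem contDiff_postcomp {V : Type u} [NormedAddCommGroup V] [NormedSpace ℝ V] (n : ℕ) :
    ∀ {W : Type u} [NormedAddCommGroup W] [NormedSpace ℝ W] (g : C(V, W)),
      ContDiff ℝ n g → ContDiff ℝ n (fun γ : C(K, V) => g.comp γ) := by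
  induction n with
  | zero =>
    intro W _ _ g _
    exact contDiff_zero.2 g.continuous_postcomp
  | succ n ih =>
    intro W _ _ g hg
    obtain ⟨g', hg', hd⟩ := contDiff_succ_iff_hasFDerivAt.1 (by exact_mod_cast hg)
    have : ContDiff ℝ (n + 1) (fun γ : C(K, V) => g.comp γ) :=
      contDiff_succ_iff_hasFDerivAt.2 ⟨_, (pointwiseBilin K (ContinuousLinearMap.id ℝ (V →L[ℝ] W))).contDiff.comp
        (ih ⟨g', hg'.continuous⟩ hg'), hasFDerivAt_postcomp g ⟨g', hg'.continuous⟩ hd⟩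
    exact_mod_cast this

end Superposition

/-! ### Primitives of continuous curves -/

section Primitive

/-- The primitive `t ↦ ∫₀ᵗ γ` of a continuous curve on `[-1, 1]`, as a bounded operator. -/
noncomputable def primitiveCLM (V : Type*) [NormedAddCommGroup V] [NormedSpace ℝ V] :
    C(Icc (-1 : ℝ) 1, V) →L[ℝ] C(Icc (-1 : ℝ) 1, V) :=
  LinearMap.mkContinuous
    { toFun := fun γ => ⟨fun t => ∫ s in (0 : ℝ)..t, IccExtend (by norm_num : (-1 : ℝ) ≤ 1) γ s,
        (intervalIntegral.continuous_primitive
          (fun a b => (γ.continuous.Icc_extend').intervalIntegrable a b) 0).comp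
          continuous_subtype_val⟩
      map_add' := fun γ γ' => by
        ext t
        simp only [ContinuousMap.coe_mk, ContinuousMap.add_apply]
        rw [← intervalIntegral.integral_add (γ.continuous.Icc_extend'.intervalIntegrable _ _)
          (γ'.continuous.Icc_extend'.intervalIntegrable _ _)]
        rfl
      map_smul' := fun c γ => by
        ext t
        simp only [ContinuousMap.coe_mk, ContinuousMap.smul_apply, RingHom.id_apply]
        rw [← intervalIntegral.integral_smul]
        rfl }
    1
    (fun γ => by
      rw [one_mul, ContinuousMap.norm_le _ (norm_nonneg _)]
      intro t
      have h := intervalIntegral.norm_integral_le_of_norm_le_const (a := (0 : ℝ)) (b := (t : ℝ))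
        (f := IccExtend (by norm_num : (-1 : ℝ) ≤ 1) γ) (C := ‖γ‖)
        (fun s _ => γ.norm_coe_le_norm _)
      refine h.trans ?_
      rw [sub_zero]
      exact mul_le_of_le_one_right (norm_nonneg _) (abs_le.2 t.2))

theorem primitiveCLM_apply {V : Type*} [NormedAddCommGroup V] [NormedSpace ℝ V]
    (γ : C(Icc (-1 : ℝ) 1, V)) (t : Icc (-1 : ℝ) 1) :
    primitiveCLM V γ t = ∫ s in (0 : ℝ)..t, IccExtend (by norm_num : (-1 : ℝ) ≤ 1) γ s := rfl

end Primitive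

/-! ### Smooth implicit functions -/

section Implicit

/-- The implicit function theorem with a neighbourhood on which the solution is smooth. -/
theorem exists_contDiffOn_implicit {E₁ E₂ : Type*} [NormedAddCommGroup E₁] [NormedSpace ℝ E₁]
    [CompleteSpace E₁] [NormedAddCommGroup E₂] [NormedSpace ℝ E₂] [CompleteSpace E₂]
    {f : E₁ × E₂ → E₂} (hf : ContDiff ℝ ∞ f) (u : E₁ × E₂) (hu : f u = 0)
    (hinv : (fderiv ℝ f u ∘L .inr ℝ E₁ E₂).IsInvertible) :
    ∃ (ψ : E₁ → E₂) (W : Set E₁), IsOpen W ∧ u.1 ∈ W ∧ ContDiffOn ℝ ∞ ψ W ∧ ψ u.1 = u.2 ∧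
      ∀ p ∈ W, f (p, ψ p) = 0 := by
  have hn : (∞ : WithTop ℕ∞) ≠ 0 := by simp
  have hat : ContDiffAt ℝ ∞ f u := hf.contDiffAt
  set ψ := hat.implicitFunction hn hinv
  have hψu : ψ u.1 = u.2 := hat.implicitFunction_apply_self hn hinv
  have hψc : ContinuousAt ψ u.1 := (hat.contDiffAt_implicitFunction hn hinv).continuousAt
  have hpair : Filter.Tendsto (fun p => (p, ψ p)) (𝓝 u.1) (𝓝 u) := by
    have : ContinuousAt (fun p => (p, ψ p)) u.1 := continuousAt_id.prodMk hψc
    simpa [ContinuousAt, hψu] using this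
  -- invertibility of the partial derivative and the equivalence `f (p, y) = 0 ↔ ψ p = y` persist
  -- near `u`; this makes `ψ` smooth on a neighbourhood, while being `C^∞` at the point `u.1` only
  -- bounds each finite order on a neighbourhood of its own
  have hinv_ev : ∀ᶠ v in 𝓝 u, (fderiv ℝ f v ∘L .inr ℝ E₁ E₂).IsInvertible := by
    have hc : Continuous fun v => fderiv ℝ f v ∘L .inr ℝ E₁ E₂ :=
      (hf.continuous_fderiv (by simp)).clm_comp continuous_const
    obtain ⟨e, he⟩ := hinv
    have := hc.continuousAt (x := u)
    exact this.eventually (by simp only [← he]; exact ContinuousLinearEquiv.nhds e)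
  have hiff := hat.eventually_apply_eq_iff_implicitFunction hn hinv
  have hzero := hat.eventually_apply_implicitFunction hn hinv
  have hcont_ev : ∀ᶠ p in 𝓝 u.1, ContinuousAt ψ p := by
    have := (hat.contDiffAt_implicitFunction hn hinv).of_le (m := 1) (by simp)
    exact (this.eventually (by simp)).mono fun _ h => h.continuousAt
  obtain ⟨W, hW, hWo, huW⟩ := eventually_nhds_iff.1
    (((hpair.eventually hinv_ev).and (hpair.eventually hiff.eventually_nhds)).and
      (hzero.and hcont_ev))
  refine ⟨ψ, W, hWo, huW, ?_, hψu, fun p hp => (hW p hp).2.1.trans hu⟩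
  intro p hp
  obtain ⟨⟨hpinv, hpiff⟩, hpz, hpc⟩ := hW p hp
  have hat' : ContDiffAt ℝ ∞ f (p, ψ p) := hf.contDiffAt
  have hχ := hat'.contDiffAt_implicitFunction hn hpinv
  have hχ0 := hat'.implicitFunction_apply_self hn hpinv
  have hχz := hat'.eventually_apply_implicitFunction hn hpinv
  -- the implicit function based at `(p, ψ p)` agrees with `ψ` near `p`
  have hpair' : Filter.Tendsto (fun q => (q, hat'.implicitFunction hn hpinv q)) (𝓝 p)
      (𝓝 (p, ψ p)) := by
    have h : ContinuousAt (fun q => (q, hat'.implicitFunction hn hpinv q)) p :=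
      continuousAt_id.prodMk hχ.continuousAt
    have h0 : hat'.implicitFunction hn hpinv p = ψ p := hχ0
    simpa [ContinuousAt, h0] using h
  refine (hχ.congr_of_eventuallyEq ?_).contDiffWithinAt
  filter_upwards [hpair'.eventually hpiff, hχz] with q hq hqz
  exact hq.1 (hqz.trans hpz)

end Implicit

/-! ### Local flows in normed spaces -/

section LocalFlow

/-- A smooth map on an open set agrees near each point with a globally defined smooth map. -/
theorem exists_contDiff_eqOn_isOpen {V W : Type*} [NormedAddCommGroup V] [NormedSpace ℝ V]
    [FiniteDimensional ℝ V] [NormedAddCommGroup W] [NormedSpace ℝ W] {f : V → W} {O : Set V}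
    (hO : IsOpen O) (hf : ContDiffOn ℝ ∞ f O) {x : V} (hx : x ∈ O) :
    ∃ g : V → W, ContDiff ℝ ∞ g ∧ ∃ N : Set V, IsOpen N ∧ x ∈ N ∧ N ⊆ O ∧ EqOn g f N := by
  obtain ⟨r, hr, hrO⟩ := Metric.isOpen_iff.1 hO x hx
  let b : ContDiffBump x := ⟨r / 4, r / 2, by positivity, by linarith⟩
  refine ⟨fun y => b y • f y, ?_, Metric.ball x (r / 4), Metric.isOpen_ball,
    Metric.mem_ball_self (by positivity),
    (Metric.ball_subset_ball (by linarith)).trans hrO, fun y hy => ?_⟩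
  · rw [contDiff_iff_contDiffAt]
    intro y
    by_cases hy : y ∈ Metric.ball x r
    · exact b.contDiff.contDiffAt.smul (hf.contDiffAt (hO.mem_nhds (hrO hy)))
    · have hev : (fun y => b y • f y) =ᶠ[𝓝 y] fun _ => 0 := by
        have : (Metric.closedBall x (r / 2))ᶜ ∈ 𝓝 y := by
          refine Metric.isClosed_closedBall.isOpen_compl.mem_nhds fun h => hy ?_
          exact Metric.closedBall_subset_ball (by linarith) h
        filter_upwards [this] with z hz
        have : b z = 0 := b.zero_of_le_dist ((not_le.1 fun h => hz (Metric.mem_closedBall.2 h)).le)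
        simp [this]
      exact contDiffAt_const.congr_of_eventuallyEq hev
  · have : b y = 1 := b.one_of_mem_closedBall (Metric.ball_subset_closedBall hy)
    simp [this]

variable {V : Type u} [NormedAddCommGroup V] [NormedSpace ℝ V]

/-- For a globally defined smooth field `f`, solutions of the rescaled integral equation: curves `γ` on `[-1, 1]` with
`γ t = x + ε ∫₀ᵗ f ∘ γ` that
depend smoothly on `(ε, x)`, for small `ε` and `x` near `x₀`. -/
theorem exists_smooth_rescaled_curves [CompleteSpace V] (f : C(V, V)) (hf : ContDiff ℝ ∞ f)
    (x₀ : V) :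
    ∃ (ψ : ℝ × V → C(Icc (-1 : ℝ) 1, V)) (W : Set (ℝ × V)), IsOpen W ∧ (0, x₀) ∈ W ∧
      ContDiffOn ℝ ∞ ψ W ∧ ψ (0, x₀) = ContinuousLinearMap.const ℝ _ x₀ ∧
      ∀ p ∈ W, ψ p = ContinuousLinearMap.const ℝ _ p.2 + p.1 • primitiveCLM V (f.comp (ψ p)) := by
  let c : V →L[ℝ] C(Icc (-1 : ℝ) 1, V) := ContinuousLinearMap.const ℝ _
  -- the equation `Φ = 0` says that `γ` solves the integral equation; at `ε = 0` its derivative in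
  -- `γ` is the identity
  let Φ : (ℝ × V) × C(Icc (-1 : ℝ) 1, V) → C(Icc (-1 : ℝ) 1, V) :=
    fun p => p.2 - c p.1.2 - p.1.1 • primitiveCLM V (f.comp p.2)
  have hN : ContDiff ℝ ∞ (fun γ : C(Icc (-1 : ℝ) 1, V) => primitiveCLM V (f.comp γ)) :=
    (primitiveCLM V).contDiff.comp (contDiff_infty.2 fun n =>
      contDiff_postcomp n f (hf.of_le (by exact_mod_cast le_top)))
  have hΦ : ContDiff ℝ ∞ Φ :=
    (contDiff_snd.sub (c.contDiff.comp (contDiff_snd.comp contDiff_fst))).sub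
      ((contDiff_fst.comp contDiff_fst).smul (hN.comp contDiff_snd))
  have hΦ0 : Φ ((0, x₀), c x₀) = 0 := by simp [Φ]
  have hpart : fderiv ℝ Φ ((0, x₀), c x₀) ∘L .inr ℝ (ℝ × V) C(Icc (-1 : ℝ) 1, V)
      = ContinuousLinearMap.id ℝ _ := by
    have h1 : HasFDerivAt Φ (fderiv ℝ Φ ((0, x₀), c x₀)) ((0, x₀), c x₀) :=
      (hΦ.differentiable (by simp)).differentiableAt.hasFDerivAt
    have h2 := h1.comp (c x₀) (hasFDerivAt_prodMk_right (𝕜 := ℝ) ((0 : ℝ), x₀) (c x₀))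
    refine h2.unique ?_
    have h3 : (Φ ∘ fun γ => (((0 : ℝ), x₀), γ)) = fun γ => γ - c x₀ := by
      ext γ : 1
      simp [Φ]
    rw [h3]
    exact (hasFDerivAt_id _).sub_const _
  obtain ⟨ψ, W, hWo, hW0, hψ, hψ0, hz⟩ := exists_contDiffOn_implicit hΦ ((0, x₀), c x₀) hΦ0
    (by rw [hpart]; exact ⟨ContinuousLinearEquiv.refl ℝ _, rfl⟩)
  refine ⟨ψ, W, hWo, hW0, hψ, hψ0, fun p hp => ?_⟩
  have := hz p hp
  simp only [Φ] at this
  rw [sub_sub, sub_eq_zero] at this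
  exact this

/-- The local flow of a smooth field on an open set, in the form `(h, x) ↦ x + h • B (h, x)`, with
`B` smooth up to and including `h = 0`. -/
theorem exists_smooth_flow_quotient [FiniteDimensional ℝ V] {f : V → V} {O : Set V}
    (hO : IsOpen O) (hf : ContDiffOn ℝ ∞ f O) {x₀ : V} (hx₀ : x₀ ∈ O) :
    ∃ (B : ℝ × V → V) (δ : ℝ), 0 < δ ∧ Metric.ball x₀ δ ⊆ O ∧
      ContDiffOn ℝ ∞ B (Ioo (-δ) δ ×ˢ Metric.ball x₀ δ) ∧
      (∀ x ∈ Metric.ball x₀ δ, B (0, x) = f x) ∧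
      ∀ h ∈ Ioo 0 δ, ∀ x ∈ Metric.ball x₀ δ, ∃ η : ℝ → V, η 0 = x ∧ η h = x + h • B (h, x) ∧
        ∀ t ∈ Ioo (-(2 * h)) (2 * h), η t ∈ O ∧ HasDerivAt η (f (η t)) t := by
  have : CompleteSpace V := FiniteDimensional.complete ℝ V
  obtain ⟨g, hg, N, hNo, hxN, hNO, hgf⟩ := exists_contDiff_eqOn_isOpen hO hf hx₀
  let G : C(V, V) := ⟨g, hg.continuous⟩
  obtain ⟨ψ, W, hWo, hW0, hψ, hψ0, hz⟩ := exists_smooth_rescaled_curves G hg x₀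
  let half : Icc (-1 : ℝ) 1 := ⟨1 / 2, by norm_num, by norm_num⟩
  -- shrink so that all the curves stay in `N`
  have hmaps : ∀ᶠ p in 𝓝 ((0 : ℝ), x₀), MapsTo (ψ p) univ N := by
    have h1 : ContinuousAt ψ (0, x₀) := (hψ.contDiffAt (hWo.mem_nhds hW0)).continuousAt
    refine h1.eventually ((ContinuousMap.isOpen_setOfPred_mapsTo isCompact_univ hNo).mem_nhds ?_)
    rw [hψ0]
    exact fun t _ => hxN
  obtain ⟨δ₁, hδ₁, hball⟩ := Metric.eventually_nhds_iff_ball.1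
    ((hWo.eventually_mem hW0).and hmaps)
  have hmem : ∀ s x, |s| < δ₁ → x ∈ Metric.ball x₀ δ₁ → (s, x) ∈ W ∧ MapsTo (ψ (s, x)) univ N := by
    intro s x hs hx
    refine hball _ ?_
    rw [← ball_prod_same]
    exact ⟨by simpa using hs, hx⟩
  have hzero : ∀ x ∈ Metric.ball x₀ δ₁, ∀ t, ψ (0, x) t = x := by
    intro x hx t
    have := hz _ (hmem 0 x (by simpa using hδ₁) hx).1
    rw [this]
    simp
  have hballN : Metric.ball x₀ δ₁ ⊆ N := fun x hx => by
    have := (hmem 0 x (by simpa using hδ₁) hx).2 (mem_univ half)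
    rwa [hzero x hx] at this
  -- the solution at time `h` is the curve with `ε = 2 h` at the rescaled time `1 / 2`, so that the
  -- integral curve exists on an open interval around `[0, h]`; with `ε = 2 h` factored out, what
  -- remains is twice the primitive at `1 / 2`
  refine ⟨fun p => (2 : ℝ) • primitiveCLM V (G.comp (ψ (2 * p.1, p.2))) half, δ₁ / 2,
    by positivity, ?_, ?_, ?_, ?_⟩
  · exact (Metric.ball_subset_ball (by linarith)).trans (hballN.trans hNO)
  · have hN : ContDiff ℝ ∞ (fun γ : C(Icc (-1 : ℝ) 1, V) =>
        ContinuousMap.evalCLM ℝ half (primitiveCLM V (G.comp γ))) :=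
      ((ContinuousMap.evalCLM ℝ half).comp (primitiveCLM V)).contDiff.comp
        (contDiff_infty.2 fun n =>
          contDiff_postcomp n G (hg.of_le (by exact_mod_cast le_top)))
    have h2 : ContDiffOn ℝ ∞ (fun p : ℝ × V => ψ (2 * p.1, p.2))
        (Ioo (-(δ₁ / 2)) (δ₁ / 2) ×ˢ Metric.ball x₀ (δ₁ / 2)) := by
      refine hψ.comp ((contDiff_const.mul contDiff_fst).prodMk contDiff_snd).contDiffOn ?_
      rintro ⟨s, x⟩ ⟨hs, hx⟩
      refine (hmem _ _ ?_ (Metric.ball_subset_ball (by linarith) hx)).1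
      rw [abs_lt]
      constructor <;> linarith [hs.1, hs.2]
    exact contDiffOn_const.smul (hN.comp_contDiffOn h2)
  · intro x hx
    have hx' := Metric.ball_subset_ball (by linarith : δ₁ / 2 ≤ δ₁) hx
    have : IccExtend (by norm_num : (-1 : ℝ) ≤ 1) (G.comp (ψ (2 * 0, x))) = fun _ => f x := by
      ext s
      have := hzero x hx' (projIcc (-1) 1 (by norm_num) s)
      simp [IccExtend, G, this, hgf (hballN hx')]
    simp only [primitiveCLM_apply, this]
    simp [half, smul_smul]
  · intro h hh x hx
    have hx' := Metric.ball_subset_ball (by linarith : δ₁ / 2 ≤ δ₁) hx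
    have h0 : 0 < h := hh.1
    obtain ⟨hW, hmaps⟩ := hmem (2 * h) x (by rw [abs_of_pos (by linarith)]; linarith [hh.2]) hx'
    have hcurve := hz _ hW
    set γ := ψ (2 * h, x)
    have hmem1 : ∀ t ∈ Ioo (-(2 * h)) (2 * h), t / (2 * h) ∈ Icc (-1 : ℝ) 1 := by
      intro t ht
      constructor
      · rw [le_div_iff₀ (by linarith)]; linarith [ht.1]
      · rw [div_le_iff₀ (by linarith)]; linarith [ht.2]
    let F : ℝ → V := fun s => IccExtend (by norm_num : (-1 : ℝ) ≤ 1) (G.comp γ) s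
    have hF : Continuous F := (G.comp γ).continuous.Icc_extend'
    let η : ℝ → V := fun t => x + (2 * h) • ∫ s in (0 : ℝ)..(t / (2 * h)), F s
    have hη : ∀ t (ht : t ∈ Ioo (-(2 * h)) (2 * h)), η t = γ ⟨t / (2 * h), hmem1 t ht⟩ := by
      intro t ht
      rw [hcurve]
      rfl
    refine ⟨η, by simp [η], ?_, fun t ht => ?_⟩
    · have : h / (2 * h) = 1 / 2 := by field_simp
      simp only [η, this, primitiveCLM_apply, smul_smul, mul_comm h 2]
      rfl
    · have hN : η t ∈ N := by
        rw [hη t ht]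
        exact hmaps (mem_univ _)
      refine ⟨hNO hN, ?_⟩
      have hd : HasDerivAt (fun s => ∫ r in (0 : ℝ)..s, F r) (F (t / (2 * h))) (t / (2 * h)) :=
        intervalIntegral.integral_hasDerivAt_right (hF.intervalIntegrable _ _)
          (hF.stronglyMeasurableAtFilter _ _) hF.continuousAt
      have hd2 : HasDerivAt η ((2 * h) • ((1 / (2 * h)) • F (t / (2 * h)))) t := by
        have h3 : HasDerivAt (fun t : ℝ => t / (2 * h)) (1 / (2 * h)) t :=
          (hasDerivAt_id t).div_const _
        exact ((hd.scomp t h3).const_smul (2 * h)).const_add x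
      have hval : (2 * h) • ((1 / (2 * h)) • F (t / (2 * h))) = f (η t) := by
        rw [smul_smul, mul_one_div_cancel (by linarith), one_smul]
        have : F (t / (2 * h)) = g (γ ⟨t / (2 * h), hmem1 t ht⟩) := by
          simp only [F]
          rw [IccExtend_of_mem _ _ (hmem1 t ht)]
          rfl
        rw [this, ← hη t ht, hgf hN]
      rwa [hval] at hd2

end LocalFlow

/-! ### Flows on manifolds -/

section ManifoldFlow

variable {E : Type u} [NormedAddCommGroup E] [NormedSpace ℝ E]
  {H : Type*} [TopologicalSpace H] {I : ModelWithCorners ℝ E H}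
  {M : Type*} [TopologicalSpace M] [ChartedSpace H M] [IsManifold I ∞ M]

/-- The vector field `X` read in the preferred chart at `x₀`, as a map of the model vector space
(meaningful on the target of the chart). -/
noncomputable def chartField (X : ∀ x : M, TangentSpace I x) (x₀ : M) (y : E) : E :=
  tangentCoordChange I ((extChartAt I x₀).symm y) x₀ ((extChartAt I x₀).symm y)
    (X ((extChartAt I x₀).symm y))

theorem contDiffOn_chartField {X : ∀ x : M, TangentSpace I x} (hX : IsSmoothVectorField X)
    (x₀ : M) : ContDiffOn ℝ ∞ (chartField X x₀) (extChartAt I x₀).target := by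
  have h1 : ContMDiffOn I.tangent 𝓘(ℝ, E × E) ∞
      (extChartAt I.tangent (⟨x₀, X x₀⟩ : TangentBundle I M))
      (chartAt (ModelProd H E) (⟨x₀, X x₀⟩ : TangentBundle I M)).source := contMDiffOn_extChartAt
  have h2 : ContMDiffOn 𝓘(ℝ, E) I ∞ (extChartAt I x₀).symm (extChartAt I x₀).target :=
    contMDiffOn_extChartAt_symm x₀
  have h3 := h1.comp (hX.comp_contMDiffOn h2) (fun y hy => by
    simpa using (extChartAt I x₀).map_target hy)
  exact contDiff_snd.comp_contDiffOn h3.contDiffOn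

variable [I.Boundaryless]

/-- A solution of the equation in the chart gives an integral curve on the manifold. -/
theorem IsMIntegralCurveOn.of_chartField {X : ∀ x : M, TangentSpace I x} {x₀ : M} {η : ℝ → E}
    {s : Set ℝ} (hη : ∀ t ∈ s, η t ∈ (extChartAt I x₀).target ∧
      HasDerivAt η (chartField X x₀ (η t)) t) :
    IsMIntegralCurveOn ((extChartAt I x₀).symm ∘ η) X s := by
  intro t ht
  obtain ⟨hf3', h⟩ := hη t ht
  let xₜ : M := (extChartAt I x₀).symm (η t)
  let v : E := X xₜ
  have h : HasDerivAt η (tangentCoordChange I xₜ x₀ xₜ v) t := h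
  have hft1 := mem_preimage.mp <|
    mem_of_mem_of_subset hf3' (extChartAt I x₀).target_subset_preimage_source
  have hft2 := mem_extChartAt_source (I := I) xₜ
  have hd : HasFDerivAt (extChartAt I xₜ ∘ (extChartAt I x₀).symm)
      (tangentCoordChange I x₀ xₜ xₜ) (η t) := by
    apply HasFDerivWithinAt.hasFDerivAt (s := range I) _ <|
      Filter.mem_of_superset ((isOpen_extChartAt_target x₀).mem_nhds hf3')
        (extChartAt_target_subset_range ..)
    rw [← (extChartAt I x₀).right_inv hf3']
    exact hasFDerivWithinAt_tangentCoordChange ⟨hft1, hft2⟩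
  have hd2 : HasDerivAt ((extChartAt I xₜ ∘ (extChartAt I x₀).symm) ∘ η) v t := by
    have h2 := hd.comp_hasDerivAt t h
    rwa [tangentCoordChange_comp ⟨⟨hft2, hft1⟩, hft2⟩, tangentCoordChange_self hft2] at h2
  apply HasMFDerivAt.hasMFDerivWithinAt
  refine ⟨(continuousAt_extChartAt_symm'' hf3').comp h.continuousAt, ?_⟩
  have h3 := hd2.hasFDerivAt.hasFDerivWithinAt (s := range 𝓘(ℝ, ℝ))
  exact h3

/-- The chart form of `exists_smooth_flow_quotient` for a vector field on a manifold; the time for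
which the flow is defined is uniform near `x₀`. -/
theorem exists_smooth_flow_quotient_chart [FiniteDimensional ℝ E] {X : ∀ x : M, TangentSpace I x}
    (hX : IsSmoothVectorField X) (x₀ : M) :
    ∃ (B : ℝ × E → E) (δ : ℝ), 0 < δ ∧
      Metric.ball (extChartAt I x₀ x₀) δ ⊆ (extChartAt I x₀).target ∧
      ContDiffOn ℝ ∞ B (Ioo (-δ) δ ×ˢ Metric.ball (extChartAt I x₀ x₀) δ) ∧
      (∀ y ∈ Metric.ball (extChartAt I x₀ x₀) δ, B (0, y) = chartField X x₀ y) ∧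
      ∀ h ∈ Ioo 0 δ, ∀ y ∈ Metric.ball (extChartAt I x₀ x₀) δ,
        (extChartAt I x₀).symm y ∈ flowDomain X h ∧
        y + h • B (h, y) ∈ (extChartAt I x₀).target ∧
        IsFlowValue X h ((extChartAt I x₀).symm y) ((extChartAt I x₀).symm (y + h • B (h, y))) := by
  obtain ⟨B, δ, hδ, hO, hB, hB0, hflow⟩ := exists_smooth_flow_quotient
    (isOpen_extChartAt_target (I := I) x₀) (contDiffOn_chartField hX x₀) (mem_extChartAt_target x₀)
  refine ⟨B, δ, hδ, hO, hB, hB0, fun h hh y hy => ?_⟩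
  obtain ⟨η, h0, h1, hη⟩ := hflow h hh y hy
  have hpos : 0 < h := hh.1
  have hcurve := IsMIntegralCurveOn.of_chartField hη
  have hval : ∀ t ∈ Icc 0 h, IsFlowValue X t ((extChartAt I x₀).symm y)
      ((extChartAt I x₀).symm (η t)) := fun t ht =>
    ⟨_, -(2 * h), 2 * h, ⟨by linarith, by linarith⟩, ⟨by linarith [ht.1], by linarith [ht.2]⟩,
      hcurve, by simp [h0], rfl⟩
  refine ⟨fun t ht => ⟨_, hval t ht⟩, ?_, ?_⟩
  · rw [← h1]
    exact (hη h ⟨by linarith, by linarith⟩).1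
  · rw [← h1]
    exact hval h ⟨hpos.le, le_rfl⟩

theorem IsFlowValue.unique [T2Space M] [CompleteSpace E]
    {X : ∀ x : M, TangentSpace I x}
    (hX : IsSmoothVectorField X) {t : ℝ} {x y y' : M} (h : IsFlowValue X t x y)
    (h' : IsFlowValue X t x y') : y = y' := by
  obtain ⟨γ, a, b, h0, ht, hγ, hγ0, hγt⟩ := h
  obtain ⟨γ', a', b', h0', ht', hγ', hγ0', hγt'⟩ := h'
  have : IsManifold I 1 M := .of_le (n := ∞) (by simp)
  have h1 : Ioo (max a a') (min b b') ⊆ Ioo a b :=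
    Ioo_subset_Ioo (le_max_left _ _) (min_le_left _ _)
  have h2 : Ioo (max a a') (min b b') ⊆ Ioo a' b' :=
    Ioo_subset_Ioo (le_max_right _ _) (min_le_right _ _)
  have := isMIntegralCurveOn_Ioo_eqOn_of_contMDiff_boundaryless (t₀ := 0)
    (a := max a a') (b := min b b')
    ⟨max_lt h0.1 h0'.1, lt_min h0.2 h0'.2⟩ (ContMDiff.of_le hX (by simp)) (hγ.mono h1) (hγ'.mono h2)
    (hγ0.trans hγ0'.symm) ⟨max_lt ht.1 ht'.1, lt_min ht.2 ht'.2⟩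
  rw [← hγt, ← hγt', this]

theorem IsFlowValue.flow_eq [T2Space M] [CompleteSpace E] {X : ∀ x : M, TangentSpace I x}
    (hX : IsSmoothVectorField X) {t : ℝ} {x y : M} (h : IsFlowValue X t x y) :
    flow X t x = y := by
  have hd : FlowDefinedAt X t x := ⟨y, h⟩
  rw [flow, dif_pos hd]
  exact hd.choose_spec.unique hX h

end ManifoldFlow

/-! ### Related vector fields, and the Hausdorff property of bundles -/

section Relatedness

theorem IsMIntegralCurveOn.map_of_related
    {E : Type*} [NormedAddCommGroup E] [NormedSpace ℝ E] {H : Type*} [TopologicalSpace H]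
    {I : ModelWithCorners ℝ E H} {M : Type*} [TopologicalSpace M] [ChartedSpace H M]
    {E' : Type*} [NormedAddCommGroup E'] [NormedSpace ℝ E'] {H' : Type*} [TopologicalSpace H']
    {I' : ModelWithCorners ℝ E' H'} {N : Type*} [TopologicalSpace N] [ChartedSpace H' N]
    {f : M → N} (hf : MDifferentiable I I' f) {X : ∀ x : M, TangentSpace I x}
    {Y : ∀ y : N, TangentSpace I' y} (hXY : ∀ x, Y (f x) = mfderiv I I' f x (X x))
    {γ : ℝ → M} {s : Set ℝ} (hγ : IsMIntegralCurveOn γ X s) :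
    IsMIntegralCurveOn (f ∘ γ) Y s := by
  intro t ht
  have h := (hf (γ t)).hasMFDerivAt.comp_hasMFDerivWithinAt t (hγ t ht)
  have he : (mfderiv I I' f (γ t)).comp ((1 : ℝ →L[ℝ] ℝ).smulRight (X (γ t))) =
      (1 : ℝ →L[ℝ] ℝ).smulRight (Y ((f ∘ γ) t)) := by
    ext
    simp [hXY]
  exact he ▸ h

theorem IsFlowValue.map_of_related
    {E : Type*} [NormedAddCommGroup E] [NormedSpace ℝ E] {H : Type*} [TopologicalSpace H]
    {I : ModelWithCorners ℝ E H} {M : Type*} [TopologicalSpace M] [ChartedSpace H M]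
    {E' : Type*} [NormedAddCommGroup E'] [NormedSpace ℝ E'] {H' : Type*} [TopologicalSpace H']
    {I' : ModelWithCorners ℝ E' H'} {N : Type*} [TopologicalSpace N] [ChartedSpace H' N]
    {f : M → N} (hf : MDifferentiable I I' f) {X : ∀ x : M, TangentSpace I x}
    {Y : ∀ y : N, TangentSpace I' y} (hXY : ∀ x, Y (f x) = mfderiv I I' f x (X x))
    {t : ℝ} {x y : M} (h : IsFlowValue X t x y) : IsFlowValue Y t (f x) (f y) := by
  obtain ⟨γ, a, b, h0, ht, hγ, rfl, rfl⟩ := h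
  exact ⟨f ∘ γ, a, b, h0, ht, hγ.map_of_related hf hXY, rfl, rfl⟩

theorem FiberBundle.t2Space_totalSpace {B F : Type*} [TopologicalSpace B] [TopologicalSpace F]
    (E : B → Type*) [TopologicalSpace (TotalSpace F E)] [∀ b, TopologicalSpace (E b)]
    [FiberBundle F E] [T2Space B] [T2Space F] : T2Space (TotalSpace F E) := by
  refine ⟨fun x y hxy => ?_⟩
  by_cases h : x.proj = y.proj
  · let e := trivializationAt F E x.proj
    have hx : x ∈ e.source := mem_trivializationAt_proj_source
    have hy : y ∈ e.source := by rw [e.mem_source, ← h]; exact e.mem_source.1 hx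
    have hne : e x ≠ e y := fun he => hxy (e.injOn hx hy he)
    obtain ⟨u, v, hu, hv, hxu, hyv, huv⟩ := t2_separation hne
    refine ⟨e.source ∩ e ⁻¹' u, e.source ∩ e ⁻¹' v,
      e.continuousOn.isOpen_inter_preimage e.open_source hu,
      e.continuousOn.isOpen_inter_preimage e.open_source hv, ⟨hx, hxu⟩, ⟨hy, hyv⟩, ?_⟩
    exact (huv.preimage e).mono inter_subset_right inter_subset_right
  · obtain ⟨u, v, hu, hv, hxu, hyv, huv⟩ := t2_separation h
    exact ⟨_, _, hu.preimage (FiberBundle.continuous_proj F E),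
      hv.preimage (FiberBundle.continuous_proj F E), hxu, hyv, huv.preimage _⟩

end Relatedness

/-! ### The local immersion theorem -/

section Immersion

/-- A map with injective derivative at a point extends, near that point, to a local diffeomorphism
`(z, c) ↦ G z + c` defined on the product with a complement of the range of the derivative. -/
theorem exists_openPartialHomeomorph_of_injective_fderiv {E E' : Type*} [NormedAddCommGroup E]
    [NormedSpace ℝ E] [FiniteDimensional ℝ E] [NormedAddCommGroup E'] [NormedSpace ℝ E']
    [FiniteDimensional ℝ E'] {G : E → E'} {Z : Set E} (hZ : IsOpen Z) (hG : ContDiffOn ℝ ∞ G Z)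
    {z₀ : E} (hz₀ : z₀ ∈ Z) (hinj : Function.Injective (fderiv ℝ G z₀)) :
    ∃ (C : Submodule ℝ E') (_ : (E × C) ≃L[ℝ] E') (e : OpenPartialHomeomorph (E × C) E'),
      (z₀, 0) ∈ e.source ∧ e.source ⊆ Z ×ˢ univ ∧ (∀ z, e (z, 0) = G z) ∧
      ContDiffOn ℝ ∞ e e.source ∧ ContDiffOn ℝ ∞ e.symm e.target := by
  have : CompleteSpace E := FiniteDimensional.complete ℝ E
  obtain ⟨C, hC⟩ := (LinearMap.range (fderiv ℝ G z₀).toLinearMap).exists_isCompl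
  have : CompleteSpace C := FiniteDimensional.complete ℝ C
  let T : E × C → E' := fun p => G p.1 + p.2
  let A : E × C →L[ℝ] E' := (fderiv ℝ G z₀).coprod C.subtypeL
  have hA : Function.Bijective A := by
    constructor
    · rw [injective_iff_map_eq_zero]
      rintro ⟨z, c⟩ h
      have h' : fderiv ℝ G z₀ z = -(c : E') := eq_neg_of_add_eq_zero_left h
      have h0 : fderiv ℝ G z₀ z = 0 := Submodule.disjoint_def.1 hC.disjoint _ ⟨z, rfl⟩
        (h' ▸ C.neg_mem c.2)
      have hz : z = 0 := hinj (h0.trans (map_zero _).symm)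
      have hc : c = 0 := by
        rw [h0, eq_comm, neg_eq_zero] at h'
        exact Subtype.ext h'
      rw [hz, hc, Prod.mk_zero_zero]
    · intro w
      obtain ⟨_, ⟨z, rfl⟩, c, hc, rfl⟩ := Submodule.mem_sup.1
        (hC.sup_eq_top ▸ Submodule.mem_top : w ∈ _)
      exact ⟨(z, ⟨c, hc⟩), rfl⟩
  let L : (E × C) ≃L[ℝ] E' :=
    (LinearEquiv.ofBijective A.toLinearMap hA).toContinuousLinearEquiv
  have hT : ContDiffOn ℝ ∞ T (Z ×ˢ univ) :=
    (hG.comp contDiffOn_fst fun p hp => hp.1).add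
      (C.subtypeL.contDiff.comp contDiff_snd).contDiffOn
  have hopen : IsOpen (Z ×ˢ (univ : Set C)) := hZ.prod isOpen_univ
  have hTd : ∀ p ∈ Z ×ˢ (univ : Set C), HasFDerivAt T ((fderiv ℝ G p.1).coprod C.subtypeL) p := by
    intro p hp
    have hGp : DifferentiableAt ℝ G p.1 :=
      (hG.contDiffAt (hZ.mem_nhds hp.1)).differentiableAt (by simp)
    have h1 : HasFDerivAt (fun p : E × C => G p.1)
        ((fderiv ℝ G p.1).comp (.fst ℝ E C)) p := hGp.hasFDerivAt.comp p hasFDerivAt_fst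
    have h2 : HasFDerivAt (fun p : E × C => (p.2 : E')) (C.subtypeL.comp (.snd ℝ E C)) p :=
      (C.subtypeL.comp (.snd ℝ E C)).hasFDerivAt
    have h3 := h1.add h2
    exact h3.congr_fderiv (by ext <;> simp)
  -- the points where the derivative of `T` is invertible, so that the inverse is smooth
  let S : Set (E × C) := {p ∈ Z ×ˢ univ |
    (fderiv ℝ T p) ∈ range ((↑) : ((E × C) ≃L[ℝ] E') → (E × C) →L[ℝ] E')}
  have hS : IsOpen S := by
    have := (hT.continuousOn_fderiv_of_isOpen hopen (by simp)).isOpen_inter_preimage hopen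
      (ContinuousLinearEquiv.isOpen (𝕜 := ℝ) (E := E × C) (F := E'))
    exact this
  have hTz : HasFDerivAt T (L : (E × C) →L[ℝ] E') (z₀, 0) := hTd (z₀, 0) ⟨hz₀, mem_univ _⟩
  have hTat : ContDiffAt ℝ ∞ T (z₀, 0) := hT.contDiffAt (hopen.mem_nhds ⟨hz₀, mem_univ _⟩)
  let e₀ := hTat.toOpenPartialHomeomorph T hTz (by simp)
  have hSz : (z₀, (0 : C)) ∈ S := ⟨⟨hz₀, mem_univ _⟩, L, hTz.fderiv.symm⟩
  refine ⟨C, L, e₀.restrOpen S hS, ⟨hTat.mem_toOpenPartialHomeomorph_source hTz (by simp), hSz⟩,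
    fun p hp => hp.2.1, fun z => by simp [e₀, T], hT.mono fun p hp => hp.2.1, ?_⟩
  intro q hq
  have hp := (e₀.restrOpen S hS).map_target hq
  obtain ⟨hpZ, L', hL'⟩ := hp.2
  have hTq : ContDiffAt ℝ ∞ T ((e₀.restrOpen S hS).symm q) := hT.contDiffAt (hopen.mem_nhds hpZ)
  refine ((e₀.restrOpen S hS).contDiffAt_symm (f₀' := L') hq ?_ hTq).contDiffWithinAt
  rw [hL']
  exact (hTq.differentiableAt (by simp)).hasFDerivAt

/-- **Local immersion theorem**: a map whose expression `G` in preferred charts is smooth with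
injective derivative at a point restricts to a smooth embedding of an open neighbourhood. -/
theorem exists_isSmoothEmbedding_of_injective_fderiv
    {E E' : Type*} [NormedAddCommGroup E]
    [NormedSpace ℝ E] [FiniteDimensional ℝ E] [NormedAddCommGroup E'] [NormedSpace ℝ E']
    [FiniteDimensional ℝ E'] {H H' : Type*} [TopologicalSpace H] [TopologicalSpace H']
    {I : ModelWithCorners ℝ E H} {J : ModelWithCorners ℝ E' H'} [I.Boundaryless] [J.Boundaryless]
    {M N : Type*} [TopologicalSpace M] [ChartedSpace H M] [IsManifold I ∞ M]
    [TopologicalSpace N] [ChartedSpace H' N] [IsManifold J ∞ N]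
    {f : M → N} {x₀ : M} {y₀ : N} {G : E → E'} {Z : Set E}
    (hZ : IsOpen Z) (hG : ContDiffOn ℝ ∞ G Z) (hx₀ : extChartAt I x₀ x₀ ∈ Z)
    (hinj : Function.Injective (fderiv ℝ G (extChartAt I x₀ x₀)))
    (hf : ∀ x ∈ (extChartAt I x₀).source, extChartAt I x₀ x ∈ Z →
      f x ∈ (extChartAt J y₀).source ∧ extChartAt J y₀ (f x) = G (extChartAt I x₀ x)) :
    ∃ U : TopologicalSpace.Opens M, x₀ ∈ U ∧
      (∀ x ∈ U, x ∈ (extChartAt I x₀).source ∧ extChartAt I x₀ x ∈ Z) ∧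
      Manifold.IsSmoothEmbedding I J ∞ (fun x : U => f x) := by
  obtain ⟨C, L, e, hez, heZ, heG, he, hes⟩ :=
    exists_openPartialHomeomorph_of_injective_fderiv hZ hG hx₀ hinj
  set φ := extChartAt I x₀
  set ψ := extChartAt J y₀
  let U : TopologicalSpace.Opens M := ⟨φ.source ∩ φ ⁻¹' {z | (z, (0 : C)) ∈ e.source},
    (continuousOn_extChartAt x₀).isOpen_inter_preimage (isOpen_extChartAt_source x₀)
      (e.open_source.preimage (Continuous.prodMk_left 0))⟩
  have hxU : x₀ ∈ U := ⟨mem_extChartAt_source x₀, hez⟩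
  have hUZ : ∀ x ∈ U, x ∈ φ.source ∧ φ x ∈ Z := fun x hx => ⟨hx.1, (heZ hx.2).1⟩
  -- in the chart `ψ` followed by the inverse of `e`, the map is `x ↦ (φ x, 0)`
  have hψf : ∀ x ∈ U, f x ∈ ψ.source ∧ ψ (f x) = e (φ x, 0) := fun x hx => by
    rw [heG]
    exact hf x hx.1 (hUZ x hx).2
  have htarget : ∀ x ∈ U, ψ (f x) ∈ e.target := fun x hx => by
    rw [(hψf x hx).2]
    exact e.map_source hx.2
  have hstraight : ∀ x ∈ U, e.symm (ψ (f x)) = (φ x, 0) := fun x hx => by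
    rw [(hψf x hx).2]
    exact e.left_inv hx.2
  -- `Ψ` is a chart of the target in which the map is linear
  let Ψ : OpenPartialHomeomorph N H' := (chartAt H' y₀).trans
    ((J.toHomeomorph.toOpenPartialHomeomorph.trans (e.symm.trans
      L.toHomeomorph.toOpenPartialHomeomorph)).trans J.toHomeomorph.symm.toOpenPartialHomeomorph)
  have hΨ : ∀ y, Ψ.extend J y = L (e.symm (ψ y)) := fun y =>
    J.toHomeomorph.apply_symm_apply _
  have hΨs : ∀ y, y ∈ Ψ.source ↔ y ∈ ψ.source ∧ ψ y ∈ e.target := fun y => by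
    simp [Ψ, ψ]
  have hΨmax : Ψ ∈ IsManifold.maximalAtlas J ∞ N := by
    refine Ψ.mem_maximalAtlas_of_contMDiffOn ?_ ?_
    · have h1 : ContMDiffOn J 𝓘(ℝ, E') ∞ (fun y => L (e.symm (ψ y))) Ψ.source := by
        refine (L.contDiff.comp_contDiffOn hes).contMDiffOn.comp
          ((contMDiffOn_extChartAt (x := y₀)).mono fun y hy => ?_) fun y hy => ((hΨs y).1 hy).2
        simpa [ψ] using ((hΨs y).1 hy).1
      exact J.contMDiffOn_symm.comp h1 fun y _ => J.range_eq_univ ▸ mem_univ _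
    · have hmem : ∀ w ∈ Ψ.target, L.symm (J w) ∈ e.source ∧ e (L.symm (J w)) ∈ ψ.target := by
        intro w hw
        simpa [Ψ, ψ, extChartAt_target, J.range_eq_univ] using hw
      have h1 : ContMDiffOn J 𝓘(ℝ, E') ∞ (fun w => e (L.symm (J w))) Ψ.target :=
        (he.comp L.symm.contDiff.contDiffOn fun w hw => hw).contMDiffOn.comp
          J.contMDiff.contMDiffOn fun w hw => (hmem w hw).1
      exact (contMDiffOn_extChartAt_symm y₀).comp h1 fun w hw => (hmem w hw).2
  have hcont : ContinuousOn f U := by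
    have h1 : ContinuousOn (fun x => ψ.symm (G (φ x))) U :=
      (continuousOn_extChartAt_symm y₀).comp (hG.continuousOn.comp
        ((continuousOn_extChartAt x₀).mono fun x hx => hx.1) fun x hx => (hUZ x hx).2)
        fun x hx => by
          rw [← (hf x hx.1 (hUZ x hx).2).2]
          exact ψ.map_source (hψf x hx).1
    refine h1.congr fun x hx => ?_
    dsimp only
    rw [← (hf x hx.1 (hUZ x hx).2).2, ψ.left_inv (hψf x hx).1]
  -- a continuous local left inverse of the map
  let m : N → M := fun y => φ.symm (e.symm (ψ y)).1
  have hm : ∀ x ∈ U, m (f x) = x := fun x hx => by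
    simp only [m, hstraight x hx]
    exact φ.left_inv hx.1
  have hmc : ∀ x ∈ U, ContinuousAt m (f x) := fun x hx => by
    have h1 : ContinuousAt ψ (f x) := continuousAt_extChartAt' (hψf x hx).1
    have h2 : ContinuousAt e.symm (ψ (f x)) := e.continuousAt_symm (htarget x hx)
    have h3 : ContinuousAt φ.symm (e.symm (ψ (f x))).1 := by
      rw [hstraight x hx]
      exact continuousAt_extChartAt_symm'' (φ.map_source hx.1)
    exact ContinuousAt.comp (f := fun y => (e.symm (ψ y)).1) h3
      ((continuousAt_fst.comp h2).comp h1)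
  refine ⟨U, hxU, hUZ, ?_, ?_, ?_⟩
  · refine Manifold.IsImmersionOfComplement.isImmersion (F := C) fun x => ?_
    have hdom : ∀ x : U, x ∈ (chartAt H (⟨x₀, hxU⟩ : U)).source := fun x => by
      have := x.2.1
      simpa [φ, TopologicalSpace.Opens.chartAt_eq] using this
    refine Manifold.IsImmersionAtOfComplement.mk_of_charts L (chartAt H (⟨x₀, hxU⟩ : U)) Ψ
      (hdom x) ((hΨs _).2 ⟨(hψf x x.2).1, htarget x x.2⟩)
      (IsManifold.chart_mem_maximalAtlas _) hΨmax
      (fun x _ => (hΨs _).2 ⟨(hψf x x.2).1, htarget x x.2⟩) ?_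
    intro z hz
    set d := (chartAt H (⟨x₀, hxU⟩ : U)).extend I
    have hz' : d (d.symm z) = z := d.right_inv hz
    have hdφ : ∀ x : U, d x = φ x := fun x => rfl
    change Ψ.extend J (f (d.symm z)) = L (z, 0)
    rw [hΨ, hstraight _ (d.symm z).2, ← hdφ, hz']
  · refine Topology.isInducing_iff_nhds.2 fun x => le_antisymm ?_ ?_
    · exact (hcont.domRestrict.continuousAt (x := x)).tendsto.le_comap
    · have h1 := hmc x x.2
      rw [ContinuousAt, hm x x.2] at h1
      refine (Filter.comap_mono h1.le_comap).trans ?_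
      rw [Filter.comap_comap, nhds_subtype_eq_comap]
      have : m ∘ (fun x : U => f x) = Subtype.val := funext fun x => hm x x.2
      rw [this]
  · intro x x' hxx'
    have := congrArg m hxx'
    simp only [hm _ x.2, hm _ x'.2] at this
    exact Subtype.ext this

end Immersion

/-! ### Second order equations in natural charts -/

section SODE

/-- Coordinate changes of the tangent bundle from the chart at the point itself are derivatives of
charts, the tangent space being identified with the model space by the preferred chart. -/
theorem tangentCoordChange_eq_mfderiv_extChartAt
    {E : Type*} [NormedAddCommGroup E] [NormedSpace ℝ E] {H : Type*} [TopologicalSpace H]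
    {I : ModelWithCorners ℝ E H} {M : Type*} [TopologicalSpace M] [ChartedSpace H M]
    [IsManifold I ∞ M] {x₀ x : M} (hx : x ∈ (extChartAt I x₀).source) (w : TangentSpace I x) :
    tangentCoordChange I x x₀ x w = mfderiv I 𝓘(ℝ, E) (extChartAt I x₀) x w := by
  have : IsManifold I 1 M := .of_le (n := ∞) (by simp)
  have h : MDifferentiableAt I 𝓘(ℝ, E) (extChartAt I x₀) x :=
    mdifferentiableAt_extChartAt (by simpa using hx)
  have h' : mfderiv I 𝓘(ℝ, E) (extChartAt I x₀) x = tangentCoordChange I x x₀ x :=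
    (if_pos h).trans rfl
  exact congrArg (fun A : E →L[ℝ] E => A w) h'.symm

variable {E : Type*} [NormedAddCommGroup E] [NormedSpace ℝ E]
  {Q : Type*} [TopologicalSpace Q] [ChartedSpace E Q] [IsManifold 𝓘(ℝ, E) ∞ Q]

theorem extChartAt_tangentBundle_apply (v₀ v : TangentBundle 𝓘(ℝ, E) Q) :
    extChartAt 𝓘(ℝ, E).tangent v₀ v = (extChartAt 𝓘(ℝ, E) v₀.proj v.proj,
      tangentCoordChange 𝓘(ℝ, E) v.proj v₀.proj v.proj v.snd) := by
  rfl

theorem mem_extChartAt_tangentBundle_source (v₀ v : TangentBundle 𝓘(ℝ, E) Q) :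
    v ∈ (extChartAt 𝓘(ℝ, E).tangent v₀).source ↔
      v.proj ∈ (extChartAt 𝓘(ℝ, E) v₀.proj).source := by
  simp

theorem verticalLift_injective (v : TangentBundle 𝓘(ℝ, E) Q) :
    Function.Injective (verticalLift v) := by
  let ι : E → TangentBundle 𝓘(ℝ, E) Q := fun w => ⟨v.proj, w⟩
  let φ := extChartAt 𝓘(ℝ, E).tangent v
  have hφι : ∀ w, φ (ι w) = (extChartAt 𝓘(ℝ, E) v.proj v.proj, w) := fun w => by
    refine (extChartAt_tangentBundle_apply v (ι w)).trans (Prod.ext rfl ?_)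
    exact tangentCoordChange_self (mem_extChartAt_source v.proj)
  let w₀ : E := v.snd
  have hι : MDifferentiableAt 𝓘(ℝ, E) 𝓘(ℝ, E).tangent ι w₀ := by
    have : ContMDiffAt 𝓘(ℝ, E) 𝓘(ℝ, E).tangent 1 ι w₀ := by
      refine Bundle.contMDiffAt_totalSpace.2 ⟨contMDiffAt_const, ?_⟩
      refine contMDiffAt_id.congr_of_eventuallyEq (Filter.Eventually.of_forall fun w => ?_)
      exact congrArg Prod.snd (hφι w)
    exact this.mdifferentiableAt (by simp)
  have hφ : MDifferentiableAt 𝓘(ℝ, E).tangent 𝓘(ℝ, E × E) φ (ι w₀) :=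
    mdifferentiableAt_extChartAt (mem_chart_source _ v)
  have hd : HasMFDerivAt 𝓘(ℝ, E) 𝓘(ℝ, E × E) (φ ∘ ι) w₀ (ContinuousLinearMap.inr ℝ E E) := by
    have h1 : φ ∘ ι = fun w => (extChartAt 𝓘(ℝ, E) v.proj v.proj, w) := funext hφι
    rw [h1]
    exact (hasFDerivAt_prodMk_right _ _).hasMFDerivAt
  have hcomp := hasMFDerivAt_unique hd (hφ.hasMFDerivAt.comp w₀ hι.hasMFDerivAt)
  intro a b hab
  have h2 : (ContinuousLinearMap.inr ℝ E E) a = (ContinuousLinearMap.inr ℝ E E) b :=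
    (congrArg (fun A : E →L[ℝ] E × E => A a) hcomp).trans
      ((congrArg (mfderiv 𝓘(ℝ, E).tangent 𝓘(ℝ, E × E) φ (ι w₀)) hab).trans
        (congrArg (fun A : E →L[ℝ] E × E => A b) hcomp).symm)
  exact congrArg Prod.snd h2

/-- The usual form `Tτ ∘ Γ = id` of the condition `S(Γ) = Δ`. -/
theorem IsSODE.mfderiv_tauQ
    {Γ : ∀ v : TangentBundle 𝓘(ℝ, E) Q, TangentSpace 𝓘(ℝ, E).tangent v} (hΓ : IsSODE Γ)
    (v : TangentBundle 𝓘(ℝ, E) Q) :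
    mfderiv 𝓘(ℝ, E).tangent 𝓘(ℝ, E) tauQ v (Γ v) = v.snd :=
  verticalLift_injective v (hΓ.verticalEndo_eq v)

/-- In a natural chart `(q, w)` of `TQ`, a second order equation has the form `q' = w`. -/
theorem IsSODE.chartField_fst
    {Γ : ∀ v : TangentBundle 𝓘(ℝ, E) Q, TangentSpace 𝓘(ℝ, E).tangent v} (hΓ : IsSODE Γ)
    (v₀ : TangentBundle 𝓘(ℝ, E) Q) {y : E × E} (hy : y ∈ (extChartAt 𝓘(ℝ, E).tangent v₀).target) :
    (chartField Γ v₀ y).1 = y.2 := by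
  set φ := extChartAt 𝓘(ℝ, E).tangent v₀
  set v := φ.symm y
  let ψ := extChartAt 𝓘(ℝ, E) v₀.proj
  have hvs : v ∈ φ.source := φ.map_target hy
  have hqs : v.proj ∈ ψ.source := (mem_extChartAt_tangentBundle_source v₀ v).1 hvs
  have h1 : chartField Γ v₀ y = mfderiv 𝓘(ℝ, E).tangent 𝓘(ℝ, E × E) φ v (Γ v) :=
    tangentCoordChange_eq_mfderiv_extChartAt hvs (Γ v)
  have hφ : MDifferentiableAt 𝓘(ℝ, E).tangent 𝓘(ℝ, E × E) φ v :=
    mdifferentiableAt_extChartAt (by simpa [φ] using hvs)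
  have hψ : MDifferentiableAt 𝓘(ℝ, E) 𝓘(ℝ, E) ψ (tauQ v) :=
    mdifferentiableAt_extChartAt ((extChartAt_source 𝓘(ℝ, E) v₀.proj) ▸ hqs)
  have hτ : MDifferentiableAt 𝓘(ℝ, E).tangent 𝓘(ℝ, E) (tauQ : TangentBundle 𝓘(ℝ, E) Q → Q) v :=
    ((Bundle.contMDiff_proj (TangentSpace 𝓘(ℝ, E) : Q → Type _)) v).mdifferentiableAt
      (n := 1) (by simp)
  have hc1 := hψ.hasMFDerivAt.comp v hτ.hasMFDerivAt
  have hc2 : HasMFDerivAt 𝓘(ℝ, E).tangent 𝓘(ℝ, E) (ψ ∘ tauQ) v _ :=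
    (hasFDerivAt_fst (𝕜 := ℝ) (p := φ v)).hasMFDerivAt.comp v hφ.hasMFDerivAt
  have h2 := congrArg (fun A : E × E →L[ℝ] E => A (Γ v)) (hasMFDerivAt_unique hc1 hc2)
  have h3 : mfderiv 𝓘(ℝ, E) 𝓘(ℝ, E) ψ (tauQ v) v.snd = (chartField Γ v₀ y).1 := by
    rw [h1]
    exact (congrArg (mfderiv 𝓘(ℝ, E) 𝓘(ℝ, E) ψ (tauQ v)) (hΓ.mfderiv_tauQ v)).symm.trans h2
  have h8 : y = φ v := (φ.right_inv hy).symm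
  rw [← h3]
  conv_rhs => rw [h8]
  exact (tangentCoordChange_eq_mfderiv_extChartAt hqs v.snd).symm

end SODE

/-! ### The inclusion of a distribution in the tangent bundle -/

section Distribution

variable {E : Type*} [NormedAddCommGroup E] [NormedSpace ℝ E]
  {Q : Type*} [TopologicalSpace Q] [ChartedSpace E Q] [IsManifold 𝓘(ℝ, E) ∞ Q]
  {F : Type*} [NormedAddCommGroup F] [NormedSpace ℝ F]
  {D : ∀ q : Q, Submodule ℝ (TangentSpace 𝓘(ℝ, E) q)}
  [TopologicalSpace (DistTotal F D)] [FiberBundle F (fun q : Q => ↥(D q))]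
  [VectorBundle ℝ F (fun q : Q => ↥(D q))]

/-- The inclusion of the total space of a distribution in `TQ`, read in the bundle charts at `v₀`. -/
noncomputable def distInclInCharts (v₀ : DistTotal F D) (z : E × F) : E × E :=
  extChartAt 𝓘(ℝ, E).tangent (distIncl v₀)
    (distIncl ((extChartAt (𝓘(ℝ, E).prod 𝓘(ℝ, F)) v₀).symm z))

omit [VectorBundle ℝ F (fun q : Q => ↥(D q))] in
theorem distInclInCharts_extChartAt (v₀ : DistTotal F D) {v : DistTotal F D}
    (hv : v ∈ (extChartAt (𝓘(ℝ, E).prod 𝓘(ℝ, F)) v₀).source) :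
    distInclInCharts v₀ (extChartAt (𝓘(ℝ, E).prod 𝓘(ℝ, F)) v₀ v) =
      extChartAt 𝓘(ℝ, E).tangent (distIncl v₀) (distIncl v) := by
  rw [distInclInCharts, PartialEquiv.left_inv _ hv]

omit [VectorBundle ℝ F (fun q : Q => ↥(D q))] in
theorem distIncl_mem_extChartAt_source (v₀ : DistTotal F D) {v : DistTotal F D}
    (hv : v ∈ (extChartAt (𝓘(ℝ, E).prod 𝓘(ℝ, F)) v₀).source) :
    distIncl v ∈ (extChartAt 𝓘(ℝ, E).tangent (distIncl v₀)).source := by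
  rw [mem_extChartAt_tangentBundle_source]
  rw [FiberBundle.extChartAt] at hv
  have h1 : v ∈ (trivializationAt F (fun q => ↥(D q)) v₀.proj).source := hv.1
  have h2 : (trivializationAt F (fun q => ↥(D q)) v₀.proj v).1 ∈
    (extChartAt 𝓘(ℝ, E) v₀.proj).source := hv.2.1
  rwa [Trivialization.coe_fst _ h1] at h2

theorem contDiffOn_distInclInCharts
    [ContMDiffVectorBundle ∞ F (fun q : Q => ↥(D q)) 𝓘(ℝ, E)]
    (hD : ContMDiff (𝓘(ℝ, E).prod 𝓘(ℝ, F)) 𝓘(ℝ, E).tangent ∞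
      (distIncl : DistTotal F D → TangentBundle 𝓘(ℝ, E) Q)) (v₀ : DistTotal F D) :
    ContDiffOn ℝ ∞ (distInclInCharts v₀) (extChartAt (𝓘(ℝ, E).prod 𝓘(ℝ, F)) v₀).target := by
  have h1 := contMDiffOn_extChartAt (I := 𝓘(ℝ, E).tangent) (n := ∞) (x := distIncl v₀)
  have h2 := contMDiffOn_extChartAt_symm (I := 𝓘(ℝ, E).prod 𝓘(ℝ, F)) (n := ∞) v₀
  have h3 := h1.comp (hD.comp_contMDiffOn h2) fun z hz => by
    have := distIncl_mem_extChartAt_source v₀ ((extChartAt _ v₀).map_target hz)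
    simpa using this
  exact h3.contDiffOn

/-- In bundle charts the inclusion of a distribution is fibrewise linear and injective. -/
theorem exists_distInclInCharts_eq (v₀ : DistTotal F D) {y : E}
    (hy : (y, (0 : F)) ∈ (extChartAt (𝓘(ℝ, E).prod 𝓘(ℝ, F)) v₀).target) :
    ∃ A : F →ₗ[ℝ] E, Function.Injective A ∧ ∀ η, distInclInCharts v₀ (y, η) = (y, A η) := by
  let e := trivializationAt F (fun q : Q => ↥(D q)) v₀.proj
  let φ := extChartAt 𝓘(ℝ, E) v₀.proj
  let q : Q := φ.symm y
  rw [FiberBundle.extChartAt_target] at hy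
  have hyt : y ∈ φ.target := hy.1.1
  have hqe : q ∈ e.baseSet := hy.1.2
  have hq : q ∈ φ.source := φ.map_target hyt
  let T : E →L[ℝ] E := tangentCoordChange 𝓘(ℝ, E) q v₀.proj q
  have hT : Function.Injective T := by
    refine Function.LeftInverse.injective
      (g := tangentCoordChange 𝓘(ℝ, E) v₀.proj q q) fun w => ?_
    rw [tangentCoordChange_comp ⟨⟨mem_extChartAt_source q, hq⟩, mem_extChartAt_source q⟩,
      tangentCoordChange_self (mem_extChartAt_source q)]
  let A : F →ₗ[ℝ] E := T.toLinearMap ∘ₗ (D q).subtype ∘ₗ e.symmₗ ℝ q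
  have hsymm : ∀ η, e.symmₗ ℝ q η = e.symm q η := congrFun (e.coe_symmₗ (R := ℝ) hqe)
  refine ⟨A, fun η η' h => ?_, fun η => ?_⟩
  · have h1 : e.symmₗ ℝ q η = e.symmₗ ℝ q η' := Subtype.ext (hT h)
    rw [hsymm, hsymm] at h1
    have h2 : e ⟨q, e.symm q η⟩ = e ⟨q, e.symm q η'⟩ := by rw [h1]
    rw [e.apply_mk_symm hqe, e.apply_mk_symm hqe] at h2
    exact congrArg Prod.snd h2
  · have h1 : (extChartAt (𝓘(ℝ, E).prod 𝓘(ℝ, F)) v₀).symm (y, η) = ⟨q, e.symm q η⟩ := by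
      rw [FiberBundle.extChartAt, e.mk_symm hqe]
      rfl
    rw [distInclInCharts, h1]
    refine (extChartAt_tangentBundle_apply _ _).trans (Prod.ext (φ.right_inv hyt) ?_)
    exact congrArg (fun w : D q => T w.1) (hsymm η).symm

/-- The inclusion of a distribution in `TQ` is an immersion. -/
theorem injective_fderiv_distInclInCharts
    [ContMDiffVectorBundle ∞ F (fun q : Q => ↥(D q)) 𝓘(ℝ, E)]
    (hD : ContMDiff (𝓘(ℝ, E).prod 𝓘(ℝ, F)) 𝓘(ℝ, E).tangent ∞
      (distIncl : DistTotal F D → TangentBundle 𝓘(ℝ, E) Q)) (v₀ : DistTotal F D) {z : E × F}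
    (hz : z ∈ (extChartAt (𝓘(ℝ, E).prod 𝓘(ℝ, F)) v₀).target) :
    Function.Injective (fderiv ℝ (distInclInCharts v₀) z) := by
  have hopen := isOpen_extChartAt_target (I := 𝓘(ℝ, E).prod 𝓘(ℝ, F)) v₀
  have hmem : ∀ z' ∈ (extChartAt (𝓘(ℝ, E).prod 𝓘(ℝ, F)) v₀).target,
      (z'.1, (0 : F)) ∈ (extChartAt (𝓘(ℝ, E).prod 𝓘(ℝ, F)) v₀).target := fun z' hz' => by
    rw [FiberBundle.extChartAt_target] at hz' ⊢
    exact ⟨hz'.1, mem_univ _⟩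
  have hd : HasFDerivAt (distInclInCharts v₀) (fderiv ℝ (distInclInCharts v₀) z) z :=
    (((contDiffOn_distInclInCharts hD v₀).contDiffAt (hopen.mem_nhds hz)).differentiableAt
      (by simp)).hasFDerivAt
  have hfst : ∀ ζ, (fderiv ℝ (distInclInCharts v₀) z ζ).1 = ζ.1 := by
    have h1 : HasFDerivAt (fun z => (distInclInCharts v₀ z).1) (.fst ℝ E F) z := by
      refine (hasFDerivAt_fst (𝕜 := ℝ)).congr_of_eventuallyEq ?_
      filter_upwards [hopen.mem_nhds hz] with z' hz'
      obtain ⟨A, -, hA⟩ := exists_distInclInCharts_eq v₀ (hmem z' hz')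
      exact congrArg Prod.fst (hA z'.2)
    intro ζ
    exact congrArg (fun B : E × F →L[ℝ] E => B ζ) (hd.fst.unique h1)
  refine (injective_iff_map_eq_zero _).2 fun ζ hζ => ?_
  have h0 : ζ.1 = 0 := by rw [← hfst, hζ, Prod.fst_zero]
  obtain ⟨A, hAinj, hA⟩ := exists_distInclInCharts_eq v₀ (hmem z hz)
  -- along the fibre the inclusion is affine
  have hline : HasDerivAt (fun s : ℝ => distInclInCharts v₀ (z + s • ζ)) (0, A ζ.2) 0 := by
    have h2 : (fun s : ℝ => distInclInCharts v₀ (z + s • ζ)) =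
        fun s : ℝ => (z.1, A z.2) + s • ((0 : E), A ζ.2) := by
      ext1 s
      have : z + s • ζ = (z.1, z.2 + s • ζ.2) := by ext <;> simp [h0]
      rw [this, hA]
      simp
    rw [h2]
    simpa using ((hasDerivAt_id (0 : ℝ)).smul_const ((0 : E), A ζ.2)).const_add (z.1, A z.2)
  have hline' : HasDerivAt (fun s : ℝ => distInclInCharts v₀ (z + s • ζ))
      (fderiv ℝ (distInclInCharts v₀) z ζ) 0 := by
    have h3 : HasDerivAt (fun s : ℝ => z + s • ζ) ζ 0 := by
      simpa using ((hasDerivAt_id (0 : ℝ)).smul_const ζ).const_add z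
    have h6 : HasFDerivAt (distInclInCharts v₀) (fderiv ℝ (distInclInCharts v₀) z)
        (z + (0 : ℝ) • ζ) := by simpa using hd
    exact h6.comp_hasDerivAt (0 : ℝ) h3
  have h4 := hline.unique hline'
  rw [hζ] at h4
  have h5 : ζ.2 = 0 := hAinj (by rw [map_zero]; exact congrArg Prod.snd h4)
  exact Prod.ext h0 h5

end Distribution

/-! ### The exponential maps -/

section Exponential

variable {E : Type*} [NormedAddCommGroup E] [NormedSpace ℝ E] [FiniteDimensional ℝ E]
  {Q : Type*} [TopologicalSpace Q] [ChartedSpace E Q] [IsManifold 𝓘(ℝ, E) ∞ Q]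

/-- If the base component of `B (0, ·)` is the fibre coordinate, then for small `h` the fibre
derivative of the base component of `B (h, ·)` is injective. -/
theorem eventually_injective_fibre_fderiv {B : ℝ × (E × E) → E × E} {δ : ℝ}
    (hδ : 0 < δ) {y₀ : E × E} (hB : ContDiffOn ℝ ∞ B (Ioo (-δ) δ ×ˢ Metric.ball y₀ δ))
    (hB0 : ∀ y ∈ Metric.ball y₀ δ, (B (0, y)).1 = y.2) :
    ∀ᶠ h in 𝓝 (0 : ℝ), ∀ w : E, (fderiv ℝ B (h, y₀) (0, (0, w))).1 = 0 → w = 0 := by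
  have : CompleteSpace E := FiniteDimensional.complete ℝ E
  have hO : IsOpen (Ioo (-δ) δ ×ˢ Metric.ball y₀ δ) := isOpen_Ioo.prod Metric.isOpen_ball
  have h0 : ((0 : ℝ), y₀) ∈ Ioo (-δ) δ ×ˢ Metric.ball y₀ δ :=
    ⟨⟨by linarith, hδ⟩, Metric.mem_ball_self hδ⟩
  let ι : E →L[ℝ] ℝ × (E × E) := (ContinuousLinearMap.inr ℝ ℝ (E × E)).comp (.inr ℝ E E)
  let N : ℝ → E →L[ℝ] E := fun h => (ContinuousLinearMap.fst ℝ E E).comp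
    ((fderiv ℝ B (h, y₀)).comp ι)
  have hN0 : N 0 = ContinuousLinearMap.id ℝ E := by
    have hd : HasFDerivAt B (fderiv ℝ B (0, y₀)) (0, y₀) :=
      ((hB.contDiffAt (hO.mem_nhds h0)).differentiableAt (by simp)).hasFDerivAt
    have h1 : HasFDerivAt (fun y => (B (0, y)).1) ((ContinuousLinearMap.fst ℝ E E).comp
        ((fderiv ℝ B (0, y₀)).comp (.inr ℝ ℝ (E × E)))) y₀ :=
      (hd.comp y₀ (hasFDerivAt_prodMk_right (𝕜 := ℝ) (0 : ℝ) y₀)).fst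
    have h2 : HasFDerivAt (fun y => (B (0, y)).1) (.snd ℝ E E) y₀ := by
      refine (hasFDerivAt_snd (𝕜 := ℝ)).congr_of_eventuallyEq ?_
      filter_upwards [Metric.ball_mem_nhds y₀ hδ] with y hy using hB0 y hy
    ext w
    exact congrArg (fun A : E × E →L[ℝ] E => A (0, w)) (h1.unique h2)
  have hNc : ContinuousAt N 0 := by
    have h1 : ContinuousAt (fderiv ℝ B) (0, y₀) :=
      (hB.continuousOn_fderiv_of_isOpen hO (by simp)).continuousAt (hO.mem_nhds h0)
    have h2 : ContinuousAt (fun h : ℝ => fderiv ℝ B (h, y₀)) 0 :=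
      ContinuousAt.comp (f := fun h : ℝ => (h, y₀)) h1 (by fun_prop)
    exact continuousAt_const.clm_comp (h2.clm_comp continuousAt_const)
  have hinv : ∀ᶠ h in 𝓝 (0 : ℝ), N h ∈ range ((↑) : (E ≃L[ℝ] E) → E →L[ℝ] E) := by
    refine hNc.eventually ?_
    rw [hN0]
    exact ContinuousLinearEquiv.nhds (ContinuousLinearEquiv.refl ℝ E)
  filter_upwards [hinv] with h hh w hw
  obtain ⟨A, hA⟩ := hh
  have h3 : A w = 0 := (congrArg (fun A : E →L[ℝ] E => A w) hA).trans hw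
  simpa using h3

variable [T2Space Q]

/-- The exponential map in charts, at a point whose flow value has coordinates `y`. -/
theorem IsSODE.sodeExp_in_chart
    {Γ : ∀ v : TangentBundle 𝓘(ℝ, E) Q, TangentSpace 𝓘(ℝ, E).tangent v} (hΓ : IsSODE Γ)
    {h : ℝ} {v₀ v : TangentBundle 𝓘(ℝ, E) Q} {y : E × E}
    (hv : v ∈ (extChartAt 𝓘(ℝ, E).tangent v₀).source)
    (hy : y ∈ (extChartAt 𝓘(ℝ, E).tangent v₀).target)
    (hflow : IsFlowValue Γ h v ((extChartAt 𝓘(ℝ, E).tangent v₀).symm y)) :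
    sodeExp Γ h v ∈ (extChartAt (𝓘(ℝ, E).prod 𝓘(ℝ, E)) (v₀.proj, v₀.proj)).source ∧
      extChartAt (𝓘(ℝ, E).prod 𝓘(ℝ, E)) (v₀.proj, v₀.proj) (sodeExp Γ h v) =
        ((extChartAt 𝓘(ℝ, E).tangent v₀ v).1, y.1) := by
  have : CompleteSpace E := FiniteDimensional.complete ℝ E
  have : T2Space (TangentBundle 𝓘(ℝ, E) Q) := FiberBundle.t2Space_totalSpace _
  have hfl : flow Γ h v = (extChartAt 𝓘(ℝ, E).tangent v₀).symm y := hflow.flow_eq hΓ.smooth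
  have hs := (extChartAt 𝓘(ℝ, E).tangent v₀).map_target hy
  rw [sodeExp, hfl, extChartAt_prod]
  refine ⟨⟨(mem_extChartAt_tangentBundle_source v₀ v).1 hv,
    (mem_extChartAt_tangentBundle_source v₀ _).1 hs⟩, Prod.ext rfl ?_⟩
  exact congrArg Prod.fst ((extChartAt 𝓘(ℝ, E).tangent v₀).right_inv hy)

variable {F : Type*} [NormedAddCommGroup F] [NormedSpace ℝ F]
  {D : ∀ q : Q, Submodule ℝ (TangentSpace 𝓘(ℝ, E) q)}
  [TopologicalSpace (DistTotal F D)] [FiberBundle F (fun q : Q => ↥(D q))]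

/-- The flow of the nonholonomic dynamics is the restriction of the flow of an extension `Γ`. -/
theorem nhExp_eq_sodeExp [VectorBundle ℝ F (fun q : Q => ↥(D q))]
    [ContMDiffVectorBundle ∞ F (fun q : Q => ↥(D q)) 𝓘(ℝ, E)]
    (hD : ContMDiff (𝓘(ℝ, E).prod 𝓘(ℝ, F)) 𝓘(ℝ, E).tangent ∞
      (distIncl : DistTotal F D → TangentBundle 𝓘(ℝ, E) Q))
    {Γnh : ∀ v : DistTotal F D, TangentSpace (𝓘(ℝ, E).prod 𝓘(ℝ, F)) v}
    {Γ : ∀ v : TangentBundle 𝓘(ℝ, E) Q, TangentSpace 𝓘(ℝ, E).tangent v} (hΓ : IsSODE Γ)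
    (hext : ∀ v : DistTotal F D, Γ (distIncl v) = dIncl v (Γnh v))
    {h : ℝ} (hh : 0 ≤ h) {v : DistTotal F D} (hv : v ∈ flowDomain Γnh h) :
    distIncl v ∈ flowDomain Γ h ∧ nhExp Γnh h v = sodeExp Γ h (distIncl v) := by
  have : CompleteSpace E := FiniteDimensional.complete ℝ E
  have : T2Space (TangentBundle 𝓘(ℝ, E) Q) := FiberBundle.t2Space_totalSpace _
  have hd : MDifferentiable (𝓘(ℝ, E).prod 𝓘(ℝ, F)) 𝓘(ℝ, E).tangent
      (distIncl : DistTotal F D → TangentBundle 𝓘(ℝ, E) Q) := hD.mdifferentiable (by simp)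
  refine ⟨fun t ht => ?_, ?_⟩
  · obtain ⟨y, hy⟩ := hv t ht
    exact ⟨_, hy.map_of_related hd hext⟩
  · have hdef : FlowDefinedAt Γnh h v := hv h ⟨hh, le_rfl⟩
    have hval : IsFlowValue Γnh h v (flow Γnh h v) := by
      rw [flow, dif_pos hdef]
      exact hdef.choose_spec
    rw [nhExp, sodeExp, (hval.map_of_related hd hext).flow_eq hΓ.smooth]
    rfl

end Exponential

theorem lemma3p3
    -- the configuration manifold `Q`
    {E : Type*} [NormedAddCommGroup E] [NormedSpace ℝ E] [FiniteDimensional ℝ E]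
    {Q : Type*} [TopologicalSpace Q] [ChartedSpace E Q] [IsManifold 𝓘(ℝ, E) ∞ Q] [T2Space Q]
    -- the regular distribution `D`: a smooth vector subbundle of `TQ`
    {F : Type*} [NormedAddCommGroup F] [NormedSpace ℝ F] [FiniteDimensional ℝ F]
    (D : ∀ q : Q, Submodule ℝ (TangentSpace 𝓘(ℝ, E) q))
    [TopologicalSpace (DistTotal F D)] [FiberBundle F (fun q : Q => ↥(D q))]
    [VectorBundle ℝ F (fun q : Q => ↥(D q))]
    [ContMDiffVectorBundle ∞ F (fun q : Q => ↥(D q)) 𝓘(ℝ, E)]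
    (hD : ContMDiff (𝓘(ℝ, E).prod 𝓘(ℝ, F)) 𝓘(ℝ, E).tangent ∞
      (distIncl : DistTotal F D → TangentBundle 𝓘(ℝ, E) Q))
    -- the regular Lagrangian `L`, and regularity of the nonholonomic system
    (L : TangentBundle 𝓘(ℝ, E) Q → ℝ) (hL : IsRegularLagrangian L)
    (hreg : IsRegularNonholonomic F D L)
    -- the nonholonomic dynamics, and a SODE on `TQ` that extends it
    (Γnh : ∀ v : DistTotal F D, TangentSpace (𝓘(ℝ, E).prod 𝓘(ℝ, F)) v)
    (hΓnh : IsNonholonomicDynamics L Γnh)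
    (Γ : ∀ v : TangentBundle 𝓘(ℝ, E) Q, TangentSpace 𝓘(ℝ, E).tangent v)
    (hΓ : IsSODE Γ)
    (hext : ∀ v : DistTotal F D, Γ (distIncl v) = dIncl v (Γnh v)) :
    (∀ h : ℝ, 0 < h → ∀ v ∈ flowDomain Γnh h,
      distIncl v ∈ flowDomain Γ h ∧ nhExp Γnh h v = sodeExp Γ h (distIncl v)) ∧
    (∀ v₀ : DistTotal F D, ∃ h₀ : ℝ, 0 < h₀ ∧ ∀ h : ℝ, 0 < h → h < h₀ →
      ∃ U : TopologicalSpace.Opens (DistTotal F D), v₀ ∈ U ∧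
        (U : Set (DistTotal F D)) ⊆ flowDomain Γnh h ∧
        Manifold.IsSmoothEmbedding (𝓘(ℝ, E).prod 𝓘(ℝ, F)) (𝓘(ℝ, E).prod 𝓘(ℝ, E)) ∞
          (fun v : U => nhExp Γnh h v)) := by
  refine ⟨fun h hh v hv => nhExp_eq_sodeExp hD hΓ hext hh.le hv, fun v₀ => ?_⟩
  obtain ⟨B, δ, hδ, hδt, hB, hB0, hflow⟩ :=
    exists_smooth_flow_quotient_chart hΓ.smooth (distIncl v₀)
  obtain ⟨_, δ', hδ', -, -, -, hflow'⟩ := exists_smooth_flow_quotient_chart hΓnh.smooth v₀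
  set φ := extChartAt 𝓘(ℝ, E).tangent (distIncl v₀)
  set χ := extChartAt (𝓘(ℝ, E).prod 𝓘(ℝ, F)) v₀
  let g : E × F → E × E := distInclInCharts v₀
  have hgv : ∀ {v}, v ∈ χ.source → g (χ v) = φ (distIncl v) := distInclInCharts_extChartAt v₀
  have hz₀ : χ v₀ ∈ χ.target := mem_extChartAt_target v₀
  have hg₀ : g (χ v₀) = φ (distIncl v₀) := hgv (mem_extChartAt_source v₀)
  have hg : ContDiffOn ℝ ∞ g χ.target := contDiffOn_distInclInCharts hD v₀
  have hχo : IsOpen χ.target := isOpen_extChartAt_target v₀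
  have hginj := injective_fderiv_distInclInCharts hD v₀ hz₀
  obtain ⟨δ₂, hδ₂, hinv⟩ := Metric.eventually_nhds_iff_ball.1
    (eventually_injective_fibre_fderiv hδ hB fun y hy =>
      (congrArg Prod.fst (hB0 y hy)).trans (hΓ.chartField_fst _ (hδt hy)))
  refine ⟨min δ (min δ' δ₂), lt_min hδ (lt_min hδ' hδ₂), fun h hpos hlt => ?_⟩
  have hhδ : h ∈ Ioo 0 δ := ⟨hpos, hlt.trans_le (min_le_left _ _)⟩
  have hhδ' : h ∈ Ioo 0 δ' :=
    ⟨hpos, hlt.trans_le ((min_le_right _ _).trans (min_le_left _ _))⟩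
  have hhδ₂ : h ∈ Metric.ball (0 : ℝ) δ₂ := by
    rw [mem_ball_zero_iff, Real.norm_of_nonneg hpos.le]
    exact hlt.trans_le ((min_le_right _ _).trans (min_le_right _ _))
  -- the part of the chart of `D` where both local flows are defined up to time `h`
  let Z : Set (E × F) := (χ.target ∩ g ⁻¹' Metric.ball (φ (distIncl v₀)) δ) ∩
    Metric.ball (χ v₀) δ'
  have hZ : IsOpen Z :=
    (hg.continuousOn.isOpen_inter_preimage hχo Metric.isOpen_ball).inter Metric.isOpen_ball
  have hZ₀ : χ v₀ ∈ Z := by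
    refine ⟨⟨hz₀, ?_⟩, Metric.mem_ball_self hδ'⟩
    rw [mem_preimage, hg₀]
    exact Metric.mem_ball_self hδ
  have hdom : ∀ v ∈ χ.source, χ v ∈ Z → v ∈ flowDomain Γnh h := fun v hv hvZ => by
    have := (hflow' h hhδ' (χ v) hvZ.2).1
    rwa [χ.left_inv hv] at this
  -- the nonholonomic exponential map in charts
  let G : E × F → E × E := fun z => ((g z).1, (g z).1 + h • (B (h, g z)).1)
  have hgZ : ContDiffOn ℝ ∞ g Z := hg.mono fun z hz => hz.1.1
  have hBg : ContDiffOn ℝ ∞ (fun z => B (h, g z)) Z :=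
    hB.comp (contDiffOn_const.prodMk hgZ) fun z hz => ⟨⟨by linarith [hhδ.1], hhδ.2⟩, hz.1.2⟩
  have hG : ContDiffOn ℝ ∞ G Z :=
    hgZ.fst.prodMk (hgZ.fst.add (contDiffOn_const.smul hBg.fst))
  have hGinj : Function.Injective (fderiv ℝ G (χ v₀)) := by
    have hgd : HasFDerivAt g (fderiv ℝ g (χ v₀)) (χ v₀) :=
      ((hgZ.contDiffAt (hZ.mem_nhds hZ₀)).differentiableAt (by simp)).hasFDerivAt
    have hBd : HasFDerivAt B (fderiv ℝ B (h, g (χ v₀))) (h, g (χ v₀)) :=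
      ((hB.contDiffAt ((isOpen_Ioo.prod Metric.isOpen_ball).mem_nhds
        (show (h, g (χ v₀)) ∈ Ioo (-δ) δ ×ˢ Metric.ball (φ (distIncl v₀)) δ from
          ⟨⟨by linarith [hhδ.1], hhδ.2⟩, hZ₀.1.2⟩))).differentiableAt (by simp)).hasFDerivAt
    have hBgd := hBd.comp (χ v₀) ((hasFDerivAt_const h (χ v₀)).prodMk hgd)
    have hGd : HasFDerivAt G _ (χ v₀) := hgd.fst.prodMk (hgd.fst.add (hBgd.fst.const_smul h))
    rw [hGd.fderiv, injective_iff_map_eq_zero]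
    intro ζ hζ
    have h1 : (fderiv ℝ g (χ v₀) ζ).1 = 0 := congrArg Prod.fst hζ
    have h2 : (fderiv ℝ g (χ v₀) ζ).1 +
        h • (fderiv ℝ B (h, g (χ v₀)) (0, fderiv ℝ g (χ v₀) ζ)).1 = 0 := congrArg Prod.snd hζ
    rw [h1, zero_add, smul_eq_zero_iff_right hpos.ne', hg₀] at h2
    have h3 : fderiv ℝ g (χ v₀) ζ = (0, (fderiv ℝ g (χ v₀) ζ).2) := Prod.ext h1 rfl
    rw [h3] at h2
    have h4 := hinv h hhδ₂ _ h2
    refine hginj ?_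
    rw [map_zero]
    exact Prod.ext h1 h4
  obtain ⟨U, hvU, hUZ, hemb⟩ := exists_isSmoothEmbedding_of_injective_fderiv
    (J := 𝓘(ℝ, E).prod 𝓘(ℝ, E)) (f := nhExp Γnh h) (x₀ := v₀) (y₀ := (v₀.proj, v₀.proj))
    hZ hG hZ₀ hGinj fun v hv hvZ => by
      obtain ⟨-, hexp⟩ := nhExp_eq_sodeExp hD hΓ hext hpos.le (hdom v hv hvZ)
      obtain ⟨-, ht, hval⟩ := hflow h hhδ (g (χ v)) hvZ.1.2
      have hs := distIncl_mem_extChartAt_source v₀ hv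
      rw [hgv hv, φ.left_inv hs] at hval
      rw [hgv hv] at ht
      rw [hexp]
      obtain ⟨hs', he⟩ := hΓ.sodeExp_in_chart hs ht hval
      refine ⟨hs', he.trans ?_⟩
      change _ = ((g (χ v)).1, (g (χ v)).1 + h • (B (h, g (χ v))).1)
      rw [hgv hv]
      rfl
  exact ⟨U, hvU, fun v hv => hdom v (hUZ v hv).1 (hUZ v hv).2, hemb⟩
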